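/- Setting. A target moves on the circle of circumference one (identified with $[0,1)$) with known velocity $v$ from an arbitrary initial position $w_0$; its position at time $n$ is $w_n=w_0+nv \pmod 1$. At each time $n\ge 1$ an agent probes a measurable set $S_n$ of Lebesgue measure $|S_n|\le\frac12$, chosen (possibly at random) on the basis of the past observations, and observes $Y_n=\mathbb 1(w_n\in S_n)+Z_n \pmod 2$, where, given the past and $S_n$, $Z_n\sim\mathrm{Bern}(p[|S_n|])$. Here $p:(0,\frac12]\to[0,\frac12)$ is continuous and non-decreasing, and $p[0]=\lim_{q\to0+}p[q]$. A strategy with stopping time $\tau$ and estimator $\widehat W_\tau$ has resolution $\delta$ and error probability $\varepsilon$ if, for every $w_0$, $\Pr(|\widehat W_\tau-w_\tau|_c\le\delta)\ge 1-\varepsilon$, where $|\cdot|_c$ is the cyclic distance. Let $I(q,p)$ be the mutual information between a $\mathrm{Bern}(q)$ input of a binary symmetric channel $\mathrm{BSC}(p)$ and its output, $C(p)=\max_{q\in[0,1]} I(q,p)$ the capacity of $\mathrm{BSC}(p)$, $C_1(p)=D(p\,\|\,1-p)$ (with $C_1(0)=\infty$ and $x/\infty=0$), and let $q^*$ be a maximizer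 of $I(q,p[q])$ over $q\in(0,\frac12]$. Theorem (two-phase search with validation). Let $\alpha\in(0,\frac12)$ be fixed. Then there is a quantity $o(1)$, a function of $(\delta,\varepsilon)$ that tends to $0$ as $\delta,\varepsilon\to0^+$ jointly, such that for all sufficiently small $\delta,\varepsilon>0$ there is a two-phase search scheme with validation that, for every known velocity $v$, has resolution $\delta$ and error probability $\varepsilon$, and whose expected stopping time satisfies, for every initial position $w_0$, $$\mathbb E[\tau]\le\left(\frac{\log(1/\alpha)}{C(p[q^*])}+\frac{\log(1/\delta)}{C(p[\alpha])}+\frac{\log(1/\varepsilon)}{C_1(p[\delta])}\right)(1+o(1)).$$ The scheme works in rounds, in the frame that moves with the target. Each round has fixed numbers of queries in three phases and uses fresh randomness: (i) a coarse non-adaptive search, which outputs an interval of size $\alpha$; (ii) a zoomed-in non-adaptive search, whose query sets lie in that interval and have measure at most $\alpha/2$, and which outputs an interval of size $\delta$; (iii) a Yamamoto–Itoh validation phase, which repeatedly probes the latter interval. If the frequency of ones in phase (iii) is within a tolerance $\gamma>0$ (a parameter of the scheme) of $1-p[\delta]$, the search stops and outputs the center of that interval; otherwise the whole search is restarted. 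-/

import Mathlib

open Set Filter Topology MeasureTheory
open scoped ENNReal

noncomputable section

namespace NoisySearch

/-! ## Information measures (natural logarithms throughout; all ratios are base-free) -/

/-- `I(q, p) = H(Y) - H(Y | X)` for `X ~ Bern(q)` and `Y` the output of a `BSC(p)` with input `X`;
`Y` is Bernoulli with parameter `q (1 - p) + (1 - q) p`. -/
def mutualInfo (q p : ℝ) : ℝ :=
  Real.binEntropy (q * (1 - p) + (1 - q) * p) - Real.binEntropy p

/-- Shannon capacity of the `BSC(p)`: supremum of the mutual information over input laws. -/
def capacity (p : ℝ) : ℝ := ⨆ q : Icc (0 : ℝ) 1, mutualInfo q p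

open Classical in
/-- Relative entropy `D(a ‖ b)` between the laws `Bern(a)` and `Bern(b)`; it is infinite when
`Bern(a)` is not absolutely continuous with respect to `Bern(b)`. -/
def relEntropy (a b : ℝ) : ℝ≥0∞ :=
  if (b = 0 ∧ a ≠ 0) ∨ (b = 1 ∧ a ≠ 1) then ⊤
  else ENNReal.ofReal (a * Real.log (a / b) + (1 - a) * Real.log ((1 - a) / (1 - b)))

/-- `C₁(p) = D(p ‖ 1 - p)`; in particular `C₁(0) = ∞`. -/
def capacityOne (p : ℝ) : ℝ≥0∞ := relEntropy p (1 - p)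

/-! ## Measurement noise -/

/-- A measurement noise function `p : (0, 1/2] → [0, 1/2)`, continuous and non-decreasing.
Values of `p` outside `(0, 1/2]` are irrelevant. -/
structure IsNoiseFunction (p : ℝ → ℝ) : Prop where
  continuousOn : ContinuousOn p (Ioc 0 (1 / 2))
  monotoneOn : MonotoneOn p (Ioc 0 (1 / 2))
  mem_Ico : ∀ q ∈ Ioc (0 : ℝ) (1 / 2), p q ∈ Ico (0 : ℝ) (1 / 2)

/-- Crossover probability for a query set of size `q ∈ [0, 1/2]`.  For null sets it is
`p[0] = lim_{q → 0+} p[q]`, which for a non-decreasing `p` is the infimum of its values. -/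
def crossover (p : ℝ → ℝ) (q : ℝ) : ℝ :=
  if 0 < q then p q else sInf (p '' Ioc 0 (1 / 2))

/-! ## Search strategies on the circle of circumference one -/

/-- A causal, possibly randomized, search strategy (for a known velocity).  `query s y` is the set
probed after the observations `y` (oldest first) when the private randomness is `s`; `halt s y`
says whether the search terminates after `y`; `estimate s y` is then the position estimate. -/
structure Strategy where
  Seed : Type
  [mSeed : MeasurableSpace Seed]
  law : Measure Seed
  [isProb : IsProbabilityMeasure law]
  query : Seed → List Bool → Set UnitAddCircle
  measurableSet_query : ∀ y, MeasurableSet {z : Seed × UnitAddCircle | z.2 ∈ query z.1 y}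
  volume_query_le : ∀ s y, volume (query s y) ≤ 1 / 2
  halt : Seed → List Bool → Prop
  measurableSet_halt : ∀ y, MeasurableSet {s | halt s y}
  estimate : Seed → List Bool → UnitAddCircle
  measurable_estimate : ∀ y, Measurable fun s => estimate s y

attribute [instance] Strategy.mSeed Strategy.isProb

/-- Position at time `n` of a target with initial position `w₀` and velocity `v`. -/
def position (w₀ v : UnitAddCircle) (n : ℕ) : UnitAddCircle := w₀ + n • v

/-- The noise source: independent uniform variables on `[0, 1]`. -/
def noiseLaw : Measure (ℕ → unitInterval) :=
  Measure.infinitePi fun _ => (volume : Measure unitInterval)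

namespace Strategy

open Classical in
/-- The first `n` observations.  The query at time `n + 1` is answered by
`Y = X + Z (mod 2)`, where `X` indicates whether the target is in the probed set, and
`Z = 1(U < p[size of the probed set])` with a fresh uniform variable `U`, so that, given the past,
`Z` is Bernoulli with parameter `p[size of the probed set]`. -/
def obs (S : Strategy) (p : ℝ → ℝ) (w₀ v : UnitAddCircle) (s : S.Seed)
    (u : ℕ → unitInterval) : ℕ → List Bool
  | 0 => []
  | n + 1 =>
    let y := obs S p w₀ v s u n
    y ++ [xor (decide (position w₀ v (n + 1) ∈ S.query s y))
      (decide ((u n : ℝ) < crossover p (volume.real (S.query s y))))]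

/-- The stopping time `τ` (the number of queries made); `⊤` if the search never stops. -/
def stopTime (S : Strategy) (p : ℝ → ℝ) (w₀ v : UnitAddCircle) (s : S.Seed)
    (u : ℕ → unitInterval) : ℕ∞ :=
  ⨅ n ∈ {n : ℕ | S.halt s (S.obs p w₀ v s u n)}, (n : ℕ∞)

/-- Joint law of the agent's randomness and the noise source, which are independent. -/
def jointLaw (S : Strategy) : Measure (S.Seed × (ℕ → unitInterval)) := S.law.prod noiseLaw

/-- `E[τ]`, for the target with initial position `w₀` and velocity `v`. -/
def expectedTime (S : Strategy) (p : ℝ → ℝ) (w₀ v : UnitAddCircle) : ℝ≥0∞ :=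
  ∫⁻ z, (S.stopTime p w₀ v z.1 z.2 : ℝ≥0∞) ∂S.jointLaw

/-- The search stops and the final position is estimated up to cyclic distance `δ`. -/
def successEvent (S : Strategy) (p : ℝ → ℝ) (w₀ v : UnitAddCircle) (δ : ℝ) :
    Set (S.Seed × (ℕ → unitInterval)) :=
  {z | ∃ n : ℕ, S.stopTime p w₀ v z.1 z.2 = n ∧
    dist (S.estimate z.1 (S.obs p w₀ v z.1 z.2 n)) (position w₀ v n) ≤ δ}

/-- For the known velocity `v`, the strategy has resolution `δ` and error probability `ε`,
whatever the initial position. -/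
def HasResolution (S : Strategy) (p : ℝ → ℝ) (v : UnitAddCircle) (δ ε : ℝ) : Prop :=
  ∀ w₀, ENNReal.ofReal (1 - ε) ≤ S.jointLaw (S.successEvent p w₀ v δ)

end Strategy

/-! ## Two-phase search with validation -/

/-- Data of a two-phase search with validation, described in the frame moving with the known
velocity.  Intervals of size `ℓ` on the circle are closed balls of radius `ℓ / 2`, given by their
centers.  One round uses a random seed and consists of

* a coarse non-adaptive search (`coarseLen` queries, chosen from the seed alone), after which
  `coarseEst` is the center of an interval of size `α`;
* a zoomed-in non-adaptive search (`zoomLen` queries, chosen from the seed and that interval alone,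
  contained in that interval and filling at most half of it), after which `zoomEst` is the center
  of an interval of size `δ`;
* a validation phase (`validLen` queries), which repeatedly probes the latter interval.

The interval is accepted if the empirical frequency of ones in the validation phase is within `tol`
of `1 - p[δ]`; otherwise a new round is started from scratch with a fresh seed. -/
structure TwoPhaseScheme (α δ : ℝ) where
  α_le : α ≤ 1 / 2
  δ_le : δ ≤ 1 / 2
  Seed : Type
  [mSeed : MeasurableSpace Seed]
  law : Measure Seed
  [isProb : IsProbabilityMeasure law]
  coarseLen : ℕ
  zoomLen : ℕ
  validLen : ℕ
  validLen_pos : 0 < validLen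
  coarseQuery : Seed → ℕ → Set UnitAddCircle
  measurableSet_coarseQuery :
    ∀ k, MeasurableSet {z : Seed × UnitAddCircle | z.2 ∈ coarseQuery z.1 k}
  volume_coarseQuery_le : ∀ s k, volume (coarseQuery s k) ≤ 1 / 2
  coarseEst : Seed → List Bool → UnitAddCircle
  measurable_coarseEst : ∀ y, Measurable fun s => coarseEst s y
  zoomQuery : Seed → UnitAddCircle → ℕ → Set UnitAddCircle
  measurableSet_zoomQuery : ∀ k,
    MeasurableSet {z : (Seed × UnitAddCircle) × UnitAddCircle | z.2 ∈ zoomQuery z.1.1 z.1.2 k}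
  zoomQuery_subset : ∀ s a k, zoomQuery s a k ⊆ Metric.closedBall a (α / 2)
  volume_zoomQuery_le : ∀ s a k, volume (zoomQuery s a k) ≤ ENNReal.ofReal (α / 2)
  zoomEst : Seed → UnitAddCircle → List Bool → UnitAddCircle
  measurable_zoomEst : ∀ y, Measurable fun z : Seed × UnitAddCircle => zoomEst z.1 z.2 y
  tol : ℝ
  tol_pos : 0 < tol

attribute [instance] TwoPhaseScheme.mSeed TwoPhaseScheme.isProb

namespace TwoPhaseScheme

variable {α δ : ℝ} (S : TwoPhaseScheme α δ)

/-- Number of queries in one round. -/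
def roundLen : ℕ := S.coarseLen + S.zoomLen + S.validLen

/-- Center of the coarse interval, from the observations `c` of the round. -/
def coarseCenter (s : S.Seed) (c : List Bool) : UnitAddCircle :=
  S.coarseEst s (c.take S.coarseLen)

/-- Center of the fine interval, from the observations `c` of the round. -/
def fineCenter (s : S.Seed) (c : List Bool) : UnitAddCircle :=
  S.zoomEst s (S.coarseCenter s c) ((c.drop S.coarseLen).take S.zoomLen)

/-- The next query of a round in which `c` has been observed so far. -/
def roundQuery (s : S.Seed) (c : List Bool) : Set UnitAddCircle :=
  if c.length < S.coarseLen then S.coarseQuery s c.length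
  else if c.length < S.coarseLen + S.zoomLen then
    S.zoomQuery s (S.coarseCenter s c) (c.length - S.coarseLen)
  else Metric.closedBall (S.fineCenter s c) (δ / 2)

/-- Acceptance of a complete round with observations `c`: the validation output is typical for a
binary source with `Pr(1) = 1 - p[δ]`. -/
def Accepts (p : ℝ → ℝ) (c : List Bool) : Prop :=
  |(((c.drop (S.coarseLen + S.zoomLen)).count true : ℕ) : ℝ) - (1 - p δ) * S.validLen|
    ≤ S.tol * S.validLen

/-- Observations of the current (incomplete) round. -/
def currentBlock (y : List Bool) : List Bool := y.drop (y.length / S.roundLen * S.roundLen)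

/-- The last `roundLen` observations. -/
def lastBlock (y : List Bool) : List Bool := y.drop (y.length - S.roundLen)

lemma measurable_coarseCenter (c : List Bool) : Measurable fun s => S.coarseCenter s c :=
  S.measurable_coarseEst _

lemma measurable_fineCenter (c : List Bool) : Measurable fun s => S.fineCenter s c :=
  (S.measurable_zoomEst _).comp (measurable_id.prodMk (S.measurable_coarseCenter c))

lemma measurableSet_roundQuery (c : List Bool) :
    MeasurableSet {z : S.Seed × UnitAddCircle | z.2 ∈ S.roundQuery z.1 c} := by
  unfold roundQuery
  split_ifs
  · exact S.measurableSet_coarseQuery _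
  · exact ((measurable_fst.prodMk ((S.measurable_coarseCenter c).comp measurable_fst)).prodMk
      measurable_snd) (S.measurableSet_zoomQuery (c.length - S.coarseLen))
  · exact measurableSet_le
      (measurable_snd.dist ((S.measurable_fineCenter c).comp measurable_fst)) measurable_const

lemma volume_roundQuery_le (s : S.Seed) (c : List Bool) :
    volume (S.roundQuery s c) ≤ 1 / 2 := by
  have half : ∀ x : ℝ, x ≤ 1 / 2 → ENNReal.ofReal x ≤ 1 / 2 := fun x hx => by
    refine (ENNReal.ofReal_le_ofReal hx).trans ?_
    rw [ENNReal.ofReal_div_of_pos two_pos]; simp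
  unfold roundQuery
  split_ifs
  · exact S.volume_coarseQuery_le _ _
  · rcases le_total 0 α with h | h
    · exact (S.volume_zoomQuery_le _ _ _).trans (half _ (by linarith [S.α_le]))
    · exact (S.volume_zoomQuery_le _ _ _).trans (half _ (by linarith))
  · rw [AddCircle.volume_closedBall]
    exact half _ ((min_le_right _ _).trans (by linarith [S.δ_le]))

/-- The search strategy of the scheme, for the noise function `p` and the known velocity `v`:
rounds with independent seeds are run one after the other until one is accepted.  All query sets
and the estimate are carried along with the target's motion. -/
def toStrategy (p : ℝ → ℝ) (v : UnitAddCircle) : Strategy where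
  Seed := ℕ → S.Seed
  law := Measure.infinitePi fun _ => S.law
  query s y := (fun x => x - (y.length + 1) • v) ⁻¹'
    S.roundQuery (s (y.length / S.roundLen)) (S.currentBlock y)
  measurableSet_query y := by
    have h : Measurable fun z : (ℕ → S.Seed) × UnitAddCircle =>
        (z.1 (y.length / S.roundLen), z.2 - (y.length + 1) • v) :=
      ((measurable_pi_apply (y.length / S.roundLen)).comp measurable_fst).prodMk
        (measurable_snd.sub_const _)
    exact h (S.measurableSet_roundQuery (S.currentBlock y))
  volume_query_le s y := by
    have h := measure_preimage_add_right volume (-((y.length + 1) • v))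
      (S.roundQuery (s (y.length / S.roundLen)) (S.currentBlock y))
    simp only [← sub_eq_add_neg] at h
    exact h.trans_le (S.volume_roundQuery_le _ _)
  halt _ y := 0 < y.length ∧ S.roundLen ∣ y.length ∧ S.Accepts p (S.lastBlock y)
  measurableSet_halt _ := MeasurableSet.const _
  estimate s y := S.fineCenter (s (y.length / S.roundLen - 1)) (S.lastBlock y) + y.length • v
  measurable_estimate y := by
    have h : Measurable fun s : ℕ → S.Seed =>
        S.fineCenter (s (y.length / S.roundLen - 1)) (S.lastBlock y) :=
      (S.measurable_fineCenter (S.lastBlock y)).comp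
        (measurable_pi_apply (y.length / S.roundLen - 1))
    exact h.add_const _

end TwoPhaseScheme

end NoisySearch

end

noncomputable section

namespace NoisySearch

/-! Fix a factor `1 + η`. In the moving frame a round searches for a fixed point, and rounds use
fresh seeds and disjoint blocks of noise, so they are independent (`measure_rounds`). If a round is
rejected with probability at most `β`, the expected number of rounds is at most `1 / (1 - β)`
(`expectedTime_le`). If moreover a round is wrongly accepted with probability at most `ε * (1 - β)`,
summation over the rounds gives error at most `ε` (`hasResolution`). So `β` need only be a small
constant, and `ε` is paid for in the validation phase alone.

Both non-adaptive searches are random codes. An arc of size `L` is cut into `2 * M` cells, and each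
query contains exactly one of the antipodal cells `j` and `j + M`, chosen by a fair coin. Every
query then has measure exactly `L / 2`, so the answers pass through a binary symmetric channel with
constant crossover `p (L / 2)`. The antipode of the true cell has the complementary codeword and is
excluded by a decoding threshold `r < 1 / 2`. Any other cell has an independent codeword, and a
Chernoff and union bound gives failure at most `2 * M * exp (-N * (log 2 - h(r)))`
(`codeLaw_confusable_le`). The coarse search (`L = 1`) has a length independent of `δ` and `ε`. The
zoomed-in search (`L = α`) takes about `log (1 / δ) / (log 2 - h(p α))` queries because `p (α / 2) ≤
p α` (`exists_zoom_length`), and `log 2 - h(p α)` is at least the capacity.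

In validation, a missed target produces ones only through flips. A change of measure from `Bern(π)`
to `Bern(1 - π)` bounds the chance of a typical output by about `exp (-N * C₁(π))`
(`noiseLaw_flips_ge`, `exists_validation_length`).

All additive constants are negligible against `log (1 / δ)`. Hence each `η > 0` is achieved for all
small `δ`, uniformly in `ε < 1` (`exists_achievesUpTo`), and the `o(1)` is the infimum of the
achievable `η`, plus `δ`. -/

instance : IsProbabilityMeasure noiseLaw := by unfold noiseLaw; infer_instance

/-! ## Independence of the rounds -/

/-- The noise variables used in round `i`, if rounds have `R` queries. -/
def shiftNoise (R i : ℕ) (u : ℕ → unitInterval) : ℕ → unitInterval := fun j => u (i * R + j)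

/-- Extension of a finite sequence of noise variables by zero. -/
def extendNoise (R : ℕ) (v : Fin R → unitInterval) : ℕ → unitInterval :=
  fun j => if h : j < R then v ⟨j, h⟩ else 0

lemma measurable_extendNoise (R : ℕ) : Measurable (extendNoise R) := by
  refine measurable_pi_lambda _ fun j => ?_
  unfold extendNoise
  by_cases h : j < R
  · simp only [h, dite_true]; fun_prop
  · simp only [h, dite_false]; fun_prop

lemma noiseLaw_map_first (R : ℕ) :
    noiseLaw.map (fun u (j : Fin R) => u j) =
      Measure.infinitePi fun _ : Fin R => (volume : Measure unitInterval) :=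
  Measure.map_infinitePi_infinitePi_of_inj (P := fun _ : ℕ => (volume : Measure unitInterval))
    Fin.val_injective

/-- Reindexing along the injection `(i, j) ↦ i * R + j` and currying turn an i.i.d. sequence into an
i.i.d. sequence of blocks. -/
lemma noiseLaw_map_blocks (R : ℕ) :
    noiseLaw.map (fun u (i : ℕ) (j : Fin R) => u (i * R + j)) =
      Measure.infinitePi fun _ : ℕ => Measure.infinitePi fun _ : Fin R =>
        (volume : Measure unitInterval) := by
  have hf : Function.Injective fun x : ℕ × Fin R => x.1 * R + (x.2 : ℕ) := by
    rintro ⟨i, j⟩ ⟨i', j'⟩ h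
    have hR : 0 < R := j.pos
    have h1 : i = i' := by
      have := congrArg (· / R) h
      simpa [add_comm, Nat.add_mul_div_right _ _ hR, Nat.div_eq_of_lt j.2,
        Nat.div_eq_of_lt j'.2] using this
    subst h1
    simpa [Fin.ext_iff] using h
  rw [← Measure.infinitePi_map_curry, ← Measure.map_infinitePi_infinitePi_of_inj
    (P := fun _ : ℕ => (volume : Measure unitInterval)) hf, Measure.map_map (by fun_prop)
    (by fun_prop)]
  rfl

/-- Since `B i` sees only the first `R` variables, it can be pulled back to finite blocks along
`extendNoise`, whatever the padding; the blocks are independent. -/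
lemma noiseLaw_rounds {R : ℕ} (B : ℕ → Set (ℕ → unitInterval)) (hB : ∀ i, MeasurableSet (B i))
    (hdep : ∀ i u u', (∀ j < R, u j = u' j) → u ∈ B i → u' ∈ B i) (n : ℕ) :
    noiseLaw {u | ∀ i < n, shiftNoise R i u ∈ B i} = ∏ i ∈ Finset.range n, noiseLaw (B i) := by
  have hdep' : ∀ i u u', (∀ j < R, u j = u' j) → (u ∈ B i ↔ u' ∈ B i) := fun i u u' h =>
    ⟨hdep i u u' h, hdep i u' u fun j hj => (h j hj).symm⟩
  have hm : ∀ i, MeasurableSet (extendNoise R ⁻¹' B i) := fun i => measurable_extendNoise R (hB i)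
  have h1 : {u | ∀ i < n, shiftNoise R i u ∈ B i} =
      (fun u (i : ℕ) (j : Fin R) => u (i * R + j)) ⁻¹'
        (Set.pi (Finset.range n) fun i => extendNoise R ⁻¹' B i) := by
    ext u
    simp only [mem_ofPred_eq, mem_preimage, Set.mem_pi, Finset.coe_range, mem_Iio]
    refine forall₂_congr fun i _ => hdep' i _ _ fun j hj => ?_
    simp [extendNoise, shiftNoise, hj]
  have h2 : ∀ i, noiseLaw (B i) = (Measure.infinitePi fun _ : Fin R =>
      (volume : Measure unitInterval)) (extendNoise R ⁻¹' B i) := by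
    intro i
    rw [← noiseLaw_map_first, Measure.map_apply (by fun_prop) (hm i)]
    congr 1
    ext u
    simp only [mem_preimage]
    refine hdep' i _ _ fun j hj => ?_
    simp [extendNoise, hj]
  rw [h1, ← Measure.map_apply (by fun_prop)
    (MeasurableSet.pi (Finset.range n).countable_toSet fun i _ => hm i), noiseLaw_map_blocks,
    Measure.infinitePi_pi _ fun i _ => hm i]
  exact Finset.prod_congr rfl fun i _ => (h2 i).symm

/-- Rounds with independent seeds and disjoint blocks of noise variables are independent, and each
of them is distributed like the first one. -/
lemma measure_rounds {Seed : Type} [MeasurableSpace Seed] (law : Measure Seed)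
    [IsProbabilityMeasure law] {R : ℕ} (A : ℕ → Set (Seed × (ℕ → unitInterval)))
    (hA : ∀ i, MeasurableSet (A i))
    (hdep : ∀ i s u u', (∀ j < R, u j = u' j) → (s, u) ∈ A i → (s, u') ∈ A i) (n : ℕ) :
    ((Measure.infinitePi fun _ : ℕ => law).prod noiseLaw)
        {z | ∀ i < n, (z.1 i, shiftNoise R i z.2) ∈ A i} =
      ∏ i ∈ Finset.range n, (law.prod noiseLaw) (A i) := by
  have hshift : ∀ i, Measurable (shiftNoise R i) := fun i => by unfold shiftNoise; fun_prop
  have hmeas : MeasurableSet {z : (ℕ → Seed) × (ℕ → unitInterval) |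
      ∀ i < n, (z.1 i, shiftNoise R i z.2) ∈ A i} := by
    have : {z : (ℕ → Seed) × (ℕ → unitInterval) | ∀ i < n, (z.1 i, shiftNoise R i z.2) ∈ A i} =
        ⋂ i ∈ Finset.range n, (fun z => (z.1 i, shiftNoise R i z.2)) ⁻¹' A i := by ext; simp
    rw [this]
    refine Finset.measurableSet_biInter _ fun i _ => ?_
    have h : Measurable fun z : (ℕ → Seed) × (ℕ → unitInterval) => shiftNoise R i z.2 :=
      (hshift i).comp measurable_snd
    have h' : Measurable fun z : (ℕ → Seed) × (ℕ → unitInterval) => z.1 i := by fun_prop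
    exact (h'.prodMk h) (hA i)
  have hsec : ∀ i, Measurable fun s => noiseLaw (Prod.mk s ⁻¹' A i) := fun i =>
    measurable_measure_prodMk_left (hA i)
  rw [Measure.prod_apply hmeas]
  -- With all seeds fixed, the noise blocks factorize; each factor then depends on one seed only,
  -- and the seeds are independent.
  have h1 : ∀ s : ℕ → Seed, noiseLaw (Prod.mk s ⁻¹' {z : (ℕ → Seed) × (ℕ → unitInterval) |
      ∀ i < n, (z.1 i, shiftNoise R i z.2) ∈ A i}) =
      ∏ i ∈ Finset.range n, noiseLaw (Prod.mk (s i) ⁻¹' A i) := fun s =>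
    noiseLaw_rounds (fun i => Prod.mk (s i) ⁻¹' A i) (fun i => measurable_prodMk_left (hA i))
      (fun i u u' h hu => hdep i _ u u' h hu) n
  simp_rw [h1]
  rw [ProbabilityTheory.lintegral_prod_eq_prod_lintegral_of_indepFun _
    (fun i (s : ℕ → Seed) => noiseLaw (Prod.mk (s i) ⁻¹' A i))
    (ProbabilityTheory.iIndepFun_infinitePi (P := fun _ : ℕ => law)
      (X := fun i s => noiseLaw (Prod.mk s ⁻¹' A i)) hsec)
    (fun i => (hsec i).comp (measurable_pi_apply i))]
  refine Finset.prod_congr rfl fun i _ => ?_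
  rw [Measure.prod_apply (hA i)]
  conv_rhs => rw [← Measure.infinitePi_map_eval (fun _ : ℕ => law) i]
  rw [lintegral_map (by exact hsec i) (by fun_prop)]

/-! ## Unrolling the rounds -/

namespace TwoPhaseScheme

variable {α δ : ℝ} (S : TwoPhaseScheme α δ)

lemma roundLen_pos : 0 < S.roundLen := by
  have := S.validLen_pos
  unfold roundLen
  omega

open Classical in
/-- The answer to the query `Q` for a target at `w₀`, if the uniform noise variable is `x`. -/
def answer (p : ℝ → ℝ) (w₀ : UnitAddCircle) (Q : Set UnitAddCircle) (x : unitInterval) : Bool :=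
  xor (decide (w₀ ∈ Q)) (decide ((x : ℝ) < crossover p (volume.real Q)))

/-- The first observations of a round, for a target at the constant position `w₀`. -/
def roundObs (p : ℝ → ℝ) (w₀ : UnitAddCircle) (s : S.Seed) (u : ℕ → unitInterval) :
    ℕ → List Bool
  | 0 => []
  | n + 1 => roundObs p w₀ s u n ++ [answer p w₀ (S.roundQuery s (roundObs p w₀ s u n)) (u n)]

variable (p : ℝ → ℝ) (w₀ v : UnitAddCircle)

@[simp] lemma length_roundObs (s : S.Seed) (u : ℕ → unitInterval) (n : ℕ) :
    (S.roundObs p w₀ s u n).length = n := by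
  induction n with
  | zero => rfl
  | succ n ih => simp [roundObs, ih]

lemma roundObs_congr (s : S.Seed) {u u' : ℕ → unitInterval} (n : ℕ) (h : ∀ j < n, u j = u' j) :
    S.roundObs p w₀ s u n = S.roundObs p w₀ s u' n := by
  induction n with
  | zero => rfl
  | succ n ih =>
    simp only [roundObs]
    rw [ih fun j hj => h j (by omega), h n (by omega)]

/-- The first `n` observations of the search. -/
def searchObs (s : ℕ → S.Seed) (u : ℕ → unitInterval) (n : ℕ) : List Bool :=
  (S.toStrategy p v).obs p w₀ v s u n

/-- The stopping time of the search. -/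
def searchTime (s : ℕ → S.Seed) (u : ℕ → unitInterval) : ℕ∞ :=
  (S.toStrategy p v).stopTime p w₀ v s u

/-- The joint law of the seeds of all rounds and the noise. -/
def searchLaw : Measure ((ℕ → S.Seed) × (ℕ → unitInterval)) :=
  (Measure.infinitePi fun _ => S.law).prod noiseLaw

instance : IsProbabilityMeasure S.searchLaw := by unfold searchLaw; infer_instance

open Classical in
lemma searchObs_succ (s : ℕ → S.Seed) (u : ℕ → unitInterval) (n : ℕ) :
    S.searchObs p w₀ v s u (n + 1) = S.searchObs p w₀ v s u n ++
      [xor (decide (position w₀ v (n + 1) ∈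
          (fun x => x - ((S.searchObs p w₀ v s u n).length + 1) • v) ⁻¹'
            S.roundQuery (s ((S.searchObs p w₀ v s u n).length / S.roundLen))
              (S.currentBlock (S.searchObs p w₀ v s u n))))
        (decide ((u n : ℝ) < crossover p (volume.real
          ((fun x => x - ((S.searchObs p w₀ v s u n).length + 1) • v) ⁻¹'
            S.roundQuery (s ((S.searchObs p w₀ v s u n).length / S.roundLen))
              (S.currentBlock (S.searchObs p w₀ v s u n))))))] := rfl

@[simp] lemma length_searchObs (s : ℕ → S.Seed) (u : ℕ → unitInterval) (n : ℕ) :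
    (S.searchObs p w₀ v s u n).length = n := by
  induction n with
  | zero => rfl
  | succ n ih => rw [searchObs_succ, List.length_append, ih]; rfl

open Classical in
-- Query sets and target are translated by the same multiple of `v`, and translation preserves
-- measure, so membership and crossover are those of a motionless target at `w₀`. This removes the
-- velocity from the problem.
lemma searchObs_add (s : ℕ → S.Seed) (u : ℕ → unitInterval) (m r : ℕ) (hr : r ≤ S.roundLen) :
    S.searchObs p w₀ v s u (m * S.roundLen + r) =
      S.searchObs p w₀ v s u (m * S.roundLen) ++
        S.roundObs p w₀ (s m) (shiftNoise S.roundLen m u) r := by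
  induction r with
  | zero => simp [roundObs]
  | succ r ih =>
    have hdiv : (m * S.roundLen + r) / S.roundLen = m := by
      rw [mul_comm, Nat.mul_add_div S.roundLen_pos, Nat.div_eq_of_lt (by omega), add_zero]
    have hblock : S.currentBlock (S.searchObs p w₀ v s u (m * S.roundLen + r)) =
        S.roundObs p w₀ (s m) (shiftNoise S.roundLen m u) r := by
      rw [currentBlock, length_searchObs, hdiv, ih (by omega),
        List.drop_append_of_le_length (by simp), List.drop_of_length_le (by simp),
        List.nil_append]
    rw [← add_assoc, searchObs_succ, hblock, length_searchObs, hdiv, ih (by omega)]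
    simp only [roundObs]
    rw [List.append_assoc]
    congr 2
    have hvol : ∀ Q : Set UnitAddCircle, volume.real
        ((fun x => x - (m * S.roundLen + r + 1) • v) ⁻¹' Q) = volume.real Q := fun Q => by
      have h := measure_preimage_add_right volume (-((m * S.roundLen + r + 1) • v)) Q
      simp only [← sub_eq_add_neg] at h
      rw [Measure.real, Measure.real, h]
    have hmem : ∀ Q : Set UnitAddCircle, position w₀ v (m * S.roundLen + r + 1) ∈
        (fun x => x - (m * S.roundLen + r + 1) • v) ⁻¹' Q ↔ w₀ ∈ Q := fun Q => by
      simp only [mem_preimage, position, add_sub_cancel_right]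
    unfold answer
    simp only [hvol, hmem, shiftNoise]
    congr!

lemma lastBlock_searchObs (s : ℕ → S.Seed) (u : ℕ → unitInterval) (m : ℕ) :
    S.lastBlock (S.searchObs p w₀ v s u ((m + 1) * S.roundLen)) =
      S.roundObs p w₀ (s m) (shiftNoise S.roundLen m u) S.roundLen := by
  rw [lastBlock, length_searchObs, add_mul, one_mul, searchObs_add S p w₀ v s u m _ le_rfl,
    List.drop_append_of_le_length (by simp), List.drop_of_length_le (by simp), List.nil_append]

/-- The round with seed `s` and noise `u` is accepted. -/
def acceptEvent : Set (S.Seed × (ℕ → unitInterval)) :=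
  {z | S.Accepts p (S.roundObs p w₀ z.1 z.2 S.roundLen)}

/-- The interval found in the round with seed `s` and noise `u` misses the target. -/
def missEvent : Set (S.Seed × (ℕ → unitInterval)) :=
  {z | w₀ ∉ Metric.closedBall (S.fineCenter z.1 (S.roundObs p w₀ z.1 z.2 S.roundLen)) (δ / 2)}

lemma halt_iff (s : ℕ → S.Seed) (u : ℕ → unitInterval) (n : ℕ) :
    (S.toStrategy p v).halt s (S.searchObs p w₀ v s u n) ↔
      ∃ m, n = (m + 1) * S.roundLen ∧
        (s m, shiftNoise S.roundLen m u) ∈ S.acceptEvent p w₀ := by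
  change (0 < (S.searchObs p w₀ v s u n).length ∧ S.roundLen ∣ (S.searchObs p w₀ v s u n).length ∧
    S.Accepts p (S.lastBlock (S.searchObs p w₀ v s u n))) ↔ _
  rw [length_searchObs]
  constructor
  · rintro ⟨h0, ⟨k, rfl⟩, h⟩
    obtain ⟨m, rfl⟩ : ∃ m, k = m + 1 := by
      rcases k with _ | m
      · simp at h0
      · exact ⟨m, rfl⟩
    refine ⟨m, mul_comm _ _, ?_⟩
    rwa [mul_comm, lastBlock_searchObs] at h
  · rintro ⟨m, rfl, h⟩
    refine ⟨Nat.mul_pos (by omega) S.roundLen_pos, dvd_mul_left _ _, ?_⟩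
    rw [lastBlock_searchObs]
    exact h

lemma searchTime_eq_of_first (s : ℕ → S.Seed) (u : ℕ → unitInterval) (m : ℕ)
    (hm : (s m, shiftNoise S.roundLen m u) ∈ S.acceptEvent p w₀)
    (hlt : ∀ i < m, (s i, shiftNoise S.roundLen i u) ∉ S.acceptEvent p w₀) :
    S.searchTime p w₀ v s u = ((m + 1) * S.roundLen : ℕ) := by
  unfold searchTime Strategy.stopTime
  apply le_antisymm
  · exact iInf₂_le (ι := ℕ) _ ((S.halt_iff p w₀ v s u _).2 ⟨m, rfl, hm⟩)
  · refine le_iInf₂ fun n hn => ?_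
    obtain ⟨k, rfl, hk⟩ := (S.halt_iff p w₀ v s u _).1 hn
    have : m ≤ k := by
      by_contra h
      exact hlt k (by omega) hk
    exact_mod_cast Nat.mul_le_mul_right _ (by omega)

/-- Layer-cake form of the stopping time: round `n` costs `roundLen` queries exactly when the rounds
before it were all rejected. If no round is accepted, the series diverges. -/
lemma searchTime_le_tsum (s : ℕ → S.Seed) (u : ℕ → unitInterval) :
    (S.searchTime p w₀ v s u : ℝ≥0∞) ≤
      ∑' n : ℕ, (S.roundLen : ℝ≥0∞) * {z : (ℕ → S.Seed) × (ℕ → unitInterval) |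
        ∀ i < n, (z.1 i, shiftNoise S.roundLen i z.2) ∈ (S.acceptEvent p w₀)ᶜ}.indicator 1
          (s, u) := by
  classical
  by_cases h : ∃ m, (s m, shiftNoise S.roundLen m u) ∈ S.acceptEvent p w₀
  · rw [S.searchTime_eq_of_first p w₀ v s u (Nat.find h) (Nat.find_spec h)
      fun i hi => Nat.find_min h hi]
    refine le_trans ?_ (ENNReal.sum_le_tsum (Finset.range (Nat.find h + 1)))
    rw [Finset.sum_congr rfl (g := fun _ => (S.roundLen : ℝ≥0∞))]
    · simp
    · intro n hn
      rw [indicator_of_mem, Pi.one_apply, mul_one]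
      intro i hi
      exact Nat.find_min h (by have := Finset.mem_range.1 hn; omega)
  · push Not at h
    have : ∀ n : ℕ, {z : (ℕ → S.Seed) × (ℕ → unitInterval) |
        ∀ i < n, (z.1 i, shiftNoise S.roundLen i z.2) ∈ (S.acceptEvent p w₀)ᶜ}.indicator
          (1 : (ℕ → S.Seed) × (ℕ → unitInterval) → ℝ≥0∞) (s, u) = 1 := fun n => by
      rw [indicator_of_mem, Pi.one_apply]
      exact fun i _ => h i
    simp_rw [this, mul_one]
    rw [ENNReal.tsum_const_eq_top_of_ne_zero]
    · exact le_top
    · simpa using S.roundLen_pos.ne'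

/-! ## Measurability of the round events -/

/-- There are countably many pasts, so it suffices that each new answer is measurable in its own
noise variable when the past is fixed. -/
lemma measurable_roundObs (s : S.Seed) (n : ℕ) :
    @Measurable _ _ _ ⊤ fun u : ℕ → unitInterval => S.roundObs p w₀ s u n := by
  let : MeasurableSpace (List Bool) := ⊤
  induction n with
  | zero => exact measurable_const
  | succ n ih =>
    have h1 : ∀ Q : Set UnitAddCircle, Measurable fun x : unitInterval => answer p w₀ Q x := by
      intro Q
      classical
      unfold answer
      have : Measurable fun x : unitInterval => decide ((x : ℝ) < crossover p (volume.real Q)) := by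
        refine measurable_to_bool ?_
        have : (fun x : unitInterval => decide ((x : ℝ) < crossover p (volume.real Q))) ⁻¹' {true} =
            {x : unitInterval | (x : ℝ) < crossover p (volume.real Q)} := by ext; simp
        rw [this]
        exact measurableSet_lt measurable_subtype_coe measurable_const
      exact (measurable_of_countable (fun b : Bool => xor (decide (w₀ ∈ Q)) b)).comp this
    have h2 : Measurable fun x : List Bool × unitInterval =>
        x.1 ++ [answer p w₀ (S.roundQuery s x.1) x.2] :=
      measurable_from_prod_countable_right fun y =>
        (measurable_of_countable fun b : Bool => y ++ [b]).comp (h1 (S.roundQuery s y))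
    exact h2.comp (ih.prodMk (measurable_pi_apply n))

lemma measurableSet_of_roundObs [Countable S.Seed] [MeasurableSingletonClass S.Seed] (n : ℕ)
    (P : S.Seed → List Bool → Prop) :
    MeasurableSet {z : S.Seed × (ℕ → unitInterval) | P z.1 (S.roundObs p w₀ z.1 z.2 n)} := by
  let : MeasurableSpace (List Bool) := ⊤
  have h : Measurable fun z : S.Seed × (ℕ → unitInterval) => P z.1 (S.roundObs p w₀ z.1 z.2 n) :=
    measurable_from_prod_countable_right fun s =>
      (measurable_of_countable (P s)).comp (S.measurable_roundObs p w₀ s n)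
  exact measurableSet_setOfPred.2 h

/-! ## Expected stopping time and error probability from those of a single round -/

lemma measure_no_accept_le [Countable S.Seed] [MeasurableSingletonClass S.Seed] {η : ℝ≥0∞}
    (hη : (S.law.prod noiseLaw) (S.acceptEvent p w₀)ᶜ ≤ η) (n : ℕ) :
    S.searchLaw {z : (ℕ → S.Seed) × (ℕ → unitInterval) |
      ∀ i < n, (z.1 i, shiftNoise S.roundLen i z.2) ∈ (S.acceptEvent p w₀)ᶜ} ≤ η ^ n := by
  have h := measure_rounds S.law (R := S.roundLen) (fun _ => (S.acceptEvent p w₀)ᶜ)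
    (fun _ => (S.measurableSet_of_roundObs p w₀ S.roundLen fun _ y => S.Accepts p y).compl)
    (fun _ s u u' huu' hu => by
      simpa only [acceptEvent, mem_compl_iff, mem_ofPred_eq, S.roundObs_congr p w₀ s _ huu']
        using hu) n
  refine (le_of_eq h).trans ?_
  rw [Finset.prod_const, Finset.card_range]
  gcongr

lemma expectedTime_le [Countable S.Seed] [MeasurableSingletonClass S.Seed] {η : ℝ≥0∞}
    (hη : (S.law.prod noiseLaw) (S.acceptEvent p w₀)ᶜ ≤ η) :
    (S.toStrategy p v).expectedTime p w₀ v ≤ S.roundLen * (1 - η)⁻¹ := by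
  have hmeas : ∀ n : ℕ, MeasurableSet {z : (ℕ → S.Seed) × (ℕ → unitInterval) |
      ∀ i < n, (z.1 i, shiftNoise S.roundLen i z.2) ∈ (S.acceptEvent p w₀)ᶜ} := by
    intro n
    have : {z : (ℕ → S.Seed) × (ℕ → unitInterval) |
        ∀ i < n, (z.1 i, shiftNoise S.roundLen i z.2) ∈ (S.acceptEvent p w₀)ᶜ} =
        ⋂ i ∈ Finset.range n,
          (fun z => (z.1 i, shiftNoise S.roundLen i z.2)) ⁻¹' (S.acceptEvent p w₀)ᶜ := by
      ext; simp
    rw [this]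
    refine Finset.measurableSet_biInter _ fun i _ => ?_
    have h : Measurable fun z : (ℕ → S.Seed) × (ℕ → unitInterval) =>
        (z.1 i, shiftNoise S.roundLen i z.2) := by unfold shiftNoise; fun_prop
    exact h (S.measurableSet_of_roundObs p w₀ S.roundLen fun _ y => S.Accepts p y).compl
  calc (S.toStrategy p v).expectedTime p w₀ v
      ≤ ∫⁻ z, ∑' n : ℕ, (S.roundLen : ℝ≥0∞) * {z : (ℕ → S.Seed) × (ℕ → unitInterval) |
        ∀ i < n, (z.1 i, shiftNoise S.roundLen i z.2) ∈ (S.acceptEvent p w₀)ᶜ}.indicator 1 z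
          ∂S.searchLaw :=
        lintegral_mono fun z => S.searchTime_le_tsum p w₀ v z.1 z.2
    _ = ∑' n : ℕ, (S.roundLen : ℝ≥0∞) *
          S.searchLaw {z : (ℕ → S.Seed) × (ℕ → unitInterval) |
            ∀ i < n, (z.1 i, shiftNoise S.roundLen i z.2) ∈ (S.acceptEvent p w₀)ᶜ} := by
        rw [lintegral_tsum fun n =>
          ((measurable_one.indicator (hmeas n)).const_mul _).aemeasurable]
        refine tsum_congr fun n => ?_
        rw [lintegral_const_mul _ (measurable_one.indicator (hmeas n)),
          lintegral_indicator_one (hmeas n)]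
    _ ≤ ∑' n : ℕ, (S.roundLen : ℝ≥0∞) * η ^ n :=
        ENNReal.tsum_le_tsum fun n => by gcongr; exact S.measure_no_accept_le p w₀ hη n
    _ = S.roundLen * (1 - η)⁻¹ := by rw [ENNReal.tsum_mul_left, ENNReal.tsum_geometric]

lemma mem_successEvent (s : ℕ → S.Seed) (u : ℕ → unitInterval) (m : ℕ) (hδ : 0 ≤ δ)
    (hm : (s m, shiftNoise S.roundLen m u) ∈ S.acceptEvent p w₀)
    (hlt : ∀ i < m, (s i, shiftNoise S.roundLen i u) ∉ S.acceptEvent p w₀)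
    (hhit : (s m, shiftNoise S.roundLen m u) ∉ S.missEvent p w₀) :
    (s, u) ∈ (S.toStrategy p v).successEvent p w₀ v δ := by
  refine ⟨(m + 1) * S.roundLen, S.searchTime_eq_of_first p w₀ v s u m hm hlt, ?_⟩
  let y := S.searchObs p w₀ v s u ((m + 1) * S.roundLen)
  change dist (S.fineCenter (s (y.length / S.roundLen - 1)) (S.lastBlock y) + y.length • v) _ ≤ δ
  simp only [y]
  rw [length_searchObs, lastBlock_searchObs, Nat.mul_div_cancel _ S.roundLen_pos,
    Nat.add_sub_cancel, position, dist_add_right, dist_comm]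
  simp only [missEvent, mem_ofPred_eq, not_not, Metric.mem_closedBall] at hhit
  linarith

lemma hasResolution [Countable S.Seed] [MeasurableSingletonClass S.Seed] {η ε : ℝ} (hδ : 0 ≤ δ)
    (hη0 : 0 ≤ η) (hη1 : η < 1) (hε : 0 ≤ ε)
    (hη : ∀ w₀, (S.law.prod noiseLaw) (S.acceptEvent p w₀)ᶜ ≤ ENNReal.ofReal η)
    (herr : ∀ w₀, (S.law.prod noiseLaw) (S.acceptEvent p w₀ ∩ S.missEvent p w₀) ≤
      ENNReal.ofReal (ε * (1 - η))) :
    (S.toStrategy p v).HasResolution p v δ ε := by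
  intro w₀
  let G : Set ((ℕ → S.Seed) × (ℕ → unitInterval)) := (S.toStrategy p v).successEvent p w₀ v δ
  change ENNReal.ofReal (1 - ε) ≤ S.searchLaw G
  have hmA := S.measurableSet_of_roundObs p w₀ S.roundLen fun _ y => S.Accepts p y
  have hmW := S.measurableSet_of_roundObs p w₀ S.roundLen fun s y =>
    w₀ ∉ Metric.closedBall (S.fineCenter s y) (δ / 2)
  let N : Set ((ℕ → S.Seed) × (ℕ → unitInterval)) :=
    {z | ∀ i, (z.1 i, shiftNoise S.roundLen i z.2) ∈ (S.acceptEvent p w₀)ᶜ}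
  -- `E n`: round `n` is the first to be accepted, and its interval misses the target. `N`: the
  -- search never stops.
  let E : ℕ → Set ((ℕ → S.Seed) × (ℕ → unitInterval)) := fun n =>
    {z | ∀ i < n + 1, (z.1 i, shiftNoise S.roundLen i z.2) ∈
      if i < n then (S.acceptEvent p w₀)ᶜ else S.acceptEvent p w₀ ∩ S.missEvent p w₀}
  have hcover : univ ⊆ G ∪ (N ∪ ⋃ n, E n) := by
    classical
    rintro ⟨s, u⟩ -
    by_cases h : ∃ m, (s m, shiftNoise S.roundLen m u) ∈ S.acceptEvent p w₀
    · by_cases hW : (s (Nat.find h), shiftNoise S.roundLen (Nat.find h) u) ∈ S.missEvent p w₀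
      · refine Or.inr (Or.inr (mem_iUnion.2 ⟨Nat.find h, fun i hi => ?_⟩))
        split_ifs with hlt
        · exact Nat.find_min h hlt
        · obtain rfl : i = Nat.find h := by omega
          exact ⟨Nat.find_spec h, hW⟩
      · exact Or.inl (S.mem_successEvent p w₀ v s u _ hδ (Nat.find_spec h)
          (fun i hi => Nat.find_min h hi) hW)
    · push Not at h
      exact Or.inr (Or.inl h)
  -- The search stops almost surely, as `η < 1`.
  have hN : S.searchLaw N = 0 := by
    have hle : ∀ n : ℕ, S.searchLaw N ≤ ENNReal.ofReal η ^ n := fun n =>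
      (measure_mono (show N ⊆ {z | ∀ i < n, (z.1 i, shiftNoise S.roundLen i z.2) ∈
        (S.acceptEvent p w₀)ᶜ} from fun z hz i _ => hz i)).trans
          (S.measure_no_accept_le p w₀ (hη w₀) n)
    have hlim := ENNReal.tendsto_pow_atTop_nhds_zero_of_lt_one
      (show ENNReal.ofReal η < 1 by simpa using hη1)
    exact le_antisymm (ge_of_tendsto' hlim hle) zero_le
  have hE : ∀ n, S.searchLaw (E n) ≤ ENNReal.ofReal η ^ n * ENNReal.ofReal (ε * (1 - η)) := by
    intro n
    have h := measure_rounds S.law (R := S.roundLen) (fun i => if i < n then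
      (S.acceptEvent p w₀)ᶜ else S.acceptEvent p w₀ ∩ S.missEvent p w₀)
      (fun i => by
        split_ifs
        · exact hmA.compl
        · exact hmA.inter hmW)
      (fun i s u u' huu' hu => by
        split_ifs at hu ⊢ <;>
        simpa only [acceptEvent, missEvent, mem_compl_iff, mem_inter_iff, mem_ofPred_eq,
          S.roundObs_congr p w₀ s _ huu'] using hu) (n + 1)
    refine (le_of_eq h).trans ?_
    rw [Finset.prod_range_succ]
    simp only [lt_irrefl, if_false]
    gcongr
    · rw [Finset.prod_congr rfl (g := fun _ => (S.law.prod noiseLaw) (S.acceptEvent p w₀)ᶜ)]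
      · rw [Finset.prod_const, Finset.card_range]
        gcongr
        exact hη w₀
      · intro i hi
        rw [if_pos (Finset.mem_range.1 hi)]
    · exact herr w₀
  have hbad : S.searchLaw (N ∪ ⋃ n, E n) ≤ ENNReal.ofReal ε := by
    calc S.searchLaw (N ∪ ⋃ n, E n) ≤ S.searchLaw N + ∑' n, S.searchLaw (E n) :=
          (measure_union_le _ _).trans (by gcongr; exact measure_iUnion_le _)
      _ ≤ 0 + ∑' n : ℕ, ENNReal.ofReal η ^ n * ENNReal.ofReal (ε * (1 - η)) := by
          rw [hN]; gcongr; exact hE _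
      _ = ENNReal.ofReal ε := by
          have h1 : (0 : ℝ) < 1 - η := by linarith
          rw [zero_add, ENNReal.tsum_mul_right, ENNReal.tsum_geometric,
            ← ENNReal.ofReal_one, ← ENNReal.ofReal_sub _ hη0, ← ENNReal.ofReal_inv_of_pos h1,
            ← ENNReal.ofReal_mul (by positivity)]
          congr 1
          field_simp
  have h1 : (1 : ℝ≥0∞) ≤ S.searchLaw G + ENNReal.ofReal ε := by
    calc (1 : ℝ≥0∞) = S.searchLaw univ := measure_univ.symm
      _ ≤ S.searchLaw (G ∪ (N ∪ ⋃ n, E n)) := measure_mono hcover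
      _ ≤ _ := (measure_union_le _ _).trans (by gcongr)
  rw [ENNReal.ofReal_sub _ hε, ENNReal.ofReal_one]
  exact tsub_le_iff_right.2 h1

/-! ## The three phases of a round -/

lemma roundQuery_of_lt (s : S.Seed) (c : List Bool) (h : c.length < S.coarseLen) :
    S.roundQuery s c = S.coarseQuery s c.length := by
  rw [roundQuery, if_pos h]

/-- The observations of the coarse search. -/
def coarseObs (s : S.Seed) (u : ℕ → unitInterval) : List Bool :=
  (List.range S.coarseLen).map fun i => answer p w₀ (S.coarseQuery s i) (u i)

/-- The center of the interval found by the coarse search. -/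
def coarseResult (s : S.Seed) (u : ℕ → unitInterval) : UnitAddCircle :=
  S.coarseEst s (S.coarseObs p w₀ s u)

/-- The observations of the zoomed-in search. -/
def zoomObs (s : S.Seed) (u : ℕ → unitInterval) : List Bool :=
  (List.range S.zoomLen).map fun i =>
    answer p w₀ (S.zoomQuery s (S.coarseResult p w₀ s u) i) (u (S.coarseLen + i))

/-- The center of the interval found by the zoomed-in search. -/
def zoomResult (s : S.Seed) (u : ℕ → unitInterval) : UnitAddCircle :=
  S.zoomEst s (S.coarseResult p w₀ s u) (S.zoomObs p w₀ s u)

/-- The observations of the validation phase. -/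
def validObs (s : S.Seed) (u : ℕ → unitInterval) : List Bool :=
  (List.range S.validLen).map fun i =>
    answer p w₀ (Metric.closedBall (S.zoomResult p w₀ s u) (δ / 2))
      (u (S.coarseLen + S.zoomLen + i))

lemma roundObs_coarse (s : S.Seed) (u : ℕ → unitInterval) (k : ℕ) (hk : k ≤ S.coarseLen) :
    S.roundObs p w₀ s u k =
      (List.range k).map fun i => answer p w₀ (S.coarseQuery s i) (u i) := by
  induction k with
  | zero => rfl
  | succ k ih =>
    rw [List.range_succ, List.map_append, ← ih (by omega), roundObs,
      S.roundQuery_of_lt _ _ (by rw [length_roundObs]; omega), length_roundObs]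
    rfl

@[simp] lemma length_coarseObs (s : S.Seed) (u : ℕ → unitInterval) :
    (S.coarseObs p w₀ s u).length = S.coarseLen := by simp [coarseObs]

@[simp] lemma length_zoomObs (s : S.Seed) (u : ℕ → unitInterval) :
    (S.zoomObs p w₀ s u).length = S.zoomLen := by simp [zoomObs]

lemma coarseCenter_append (s : S.Seed) (u : ℕ → unitInterval) (y : List Bool) :
    S.coarseCenter s (S.coarseObs p w₀ s u ++ y) = S.coarseResult p w₀ s u := by
  rw [coarseCenter, List.take_append_of_le_length (by simp), List.take_of_length_le (by simp)]
  rfl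

lemma fineCenter_append (s : S.Seed) (u : ℕ → unitInterval) (y : List Bool) :
    S.fineCenter s (S.coarseObs p w₀ s u ++ (S.zoomObs p w₀ s u ++ y)) =
      S.zoomResult p w₀ s u := by
  rw [fineCenter, coarseCenter_append, List.drop_append_of_le_length (by simp),
    List.drop_of_length_le (by simp), List.nil_append, List.take_append_of_le_length (by simp),
    List.take_of_length_le (by simp)]
  rfl

lemma roundObs_zoom (s : S.Seed) (u : ℕ → unitInterval) (k : ℕ) (hk : k ≤ S.zoomLen) :
    S.roundObs p w₀ s u (S.coarseLen + k) = S.coarseObs p w₀ s u ++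
      (List.range k).map fun i =>
        answer p w₀ (S.zoomQuery s (S.coarseResult p w₀ s u) i) (u (S.coarseLen + i)) := by
  induction k with
  | zero => simpa [coarseObs] using S.roundObs_coarse p w₀ s u _ le_rfl
  | succ k ih =>
    rw [List.range_succ, List.map_append, ← List.append_assoc, ← ih (by omega), ← add_assoc,
      roundObs]
    congr 2
    rw [roundQuery, length_roundObs, if_neg (by omega), if_pos (by omega), ih (by omega),
      coarseCenter_append, Nat.add_sub_cancel_left]

lemma roundObs_valid (s : S.Seed) (u : ℕ → unitInterval) (k : ℕ) :
    S.roundObs p w₀ s u (S.coarseLen + S.zoomLen + k) = S.coarseObs p w₀ s u ++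
      (S.zoomObs p w₀ s u ++ (List.range k).map fun i =>
        answer p w₀ (Metric.closedBall (S.zoomResult p w₀ s u) (δ / 2))
          (u (S.coarseLen + S.zoomLen + i))) := by
  induction k with
  | zero => simpa [zoomObs] using S.roundObs_zoom p w₀ s u _ le_rfl
  | succ k ih =>
    rw [List.range_succ, List.map_append, ← List.append_assoc, ← List.append_assoc,
      List.append_assoc (S.coarseObs p w₀ s u), ← ih, ← add_assoc, roundObs]
    congr 2
    rw [roundQuery, length_roundObs, if_neg (by omega), if_neg (by omega), ih, fineCenter_append]

/-- Adaptivity within a round enters only through the two centers: each phase is a list of answers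
to queries that are fixed before the phase begins. -/
lemma roundObs_roundLen (s : S.Seed) (u : ℕ → unitInterval) :
    S.roundObs p w₀ s u S.roundLen =
      S.coarseObs p w₀ s u ++ (S.zoomObs p w₀ s u ++ S.validObs p w₀ s u) :=
  S.roundObs_valid p w₀ s u _

lemma mem_missEvent_iff (z : S.Seed × (ℕ → unitInterval)) :
    z ∈ S.missEvent p w₀ ↔ w₀ ∉ Metric.closedBall (S.zoomResult p w₀ z.1 z.2) (δ / 2) := by
  rw [missEvent, mem_ofPred_eq, roundObs_roundLen, fineCenter_append]

lemma mem_acceptEvent_iff (z : S.Seed × (ℕ → unitInterval)) :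
    z ∈ S.acceptEvent p w₀ ↔
      |(((S.validObs p w₀ z.1 z.2).count true : ℕ) : ℝ) - (1 - p δ) * S.validLen|
        ≤ S.tol * S.validLen := by
  rw [acceptEvent, mem_ofPred_eq, roundObs_roundLen, Accepts, ← List.append_assoc,
    List.drop_append_of_le_length (by simp), List.drop_of_length_le (by simp), List.nil_append]

end TwoPhaseScheme

/-! ## Concentration of the number of flips -/

/-- The noise variable `u n` flips an answer with crossover probability `π`. -/
def flip (π : ℝ) (u : ℕ → unitInterval) (n : ℕ) : Bool := decide ((u n : ℝ) < π)

/-- Number of flips at the times `k, ..., k + N - 1`. -/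
def flips (π : ℝ) (k N : ℕ) (u : ℕ → unitInterval) : ℕ :=
  ((Finset.range N).filter fun i => flip π u (k + i) = true).card

lemma measurableSet_lt_unitInterval (π : ℝ) : MeasurableSet {x : unitInterval | (x : ℝ) < π} :=
  measurableSet_lt measurable_subtype_coe measurable_const

lemma volume_lt_unitInterval {π : ℝ} (h1 : π ≤ 1) :
    volume {x : unitInterval | (x : ℝ) < π} = ENNReal.ofReal π := by
  rw [unitInterval.volume_apply]
  have : ((↑) '' {x : unitInterval | (x : ℝ) < π} : Set ℝ) = Ico 0 π := by
    ext x
    simp only [mem_image, mem_ofPred_eq, Subtype.exists, exists_and_left, mem_Ico]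
    constructor
    · rintro ⟨y, hy, hm, rfl⟩
      exact ⟨hm.1, hy⟩
    · rintro ⟨ha, hb⟩
      exact ⟨x, hb, ⟨ha, by linarith⟩, rfl⟩
  rw [this, Real.volume_Ico, sub_zero]

/-- The indicator of `x < π`. -/
def flipIndicator (π : ℝ) (x : unitInterval) : ℝ := {x : unitInterval | (x : ℝ) < π}.indicator 1 x

lemma measurable_flipIndicator (π : ℝ) : Measurable (flipIndicator π) :=
  measurable_one.indicator (measurableSet_lt_unitInterval π)

lemma flipIndicator_eq (π : ℝ) (u : ℕ → unitInterval) (n : ℕ) :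
    flipIndicator π (u n) = if flip π u n = true then 1 else 0 := by
  unfold flipIndicator flip
  by_cases h : (u n : ℝ) < π <;> simp [h]

lemma flips_eq_sum (π : ℝ) (k N : ℕ) (u : ℕ → unitInterval) :
    (flips π k N u : ℝ) = ∑ i ∈ Finset.range N, flipIndicator π (u (k + i)) := by
  simp_rw [flipIndicator_eq]
  rw [flips, Finset.sum_ite]
  simp

lemma iIndepFun_noiseLaw {β : Type*} [MeasurableSpace β] {f : unitInterval → β} (hf : Measurable f)
    (k : ℕ) : ProbabilityTheory.iIndepFun (fun i (u : ℕ → unitInterval) => f (u (k + i)))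
      noiseLaw :=
  (ProbabilityTheory.iIndepFun_infinitePi (P := fun _ : ℕ => (volume : Measure unitInterval))
    (X := fun _ => f) fun _ => hf).precomp (add_right_injective k)

lemma noiseLaw_map_eval (n : ℕ) : noiseLaw.map (fun u => u n) = volume :=
  Measure.infinitePi_map_eval (fun _ : ℕ => (volume : Measure unitInterval)) n

lemma integral_flipIndicator {π : ℝ} (h0 : 0 ≤ π) (h1 : π ≤ 1) (n : ℕ) :
    ∫ u, flipIndicator π (u n) ∂noiseLaw = π := by
  rw [← integral_map (φ := fun u : ℕ → unitInterval => u n)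
    (measurable_pi_apply n).aemeasurable
    (measurable_flipIndicator π).aestronglyMeasurable, noiseLaw_map_eval]
  change ∫ x, indicator _ 1 x = π
  rw [integral_indicator_one (measurableSet_lt_unitInterval π), Measure.real,
    volume_lt_unitInterval h1, ENNReal.toReal_ofReal h0]

lemma flipIndicator_mem (π : ℝ) (x : unitInterval) : flipIndicator π x ∈ Icc (0 : ℝ) 1 := by
  unfold flipIndicator indicator
  split_ifs <;> simp

/-- Chebyshev's inequality for the number of flips. -/
lemma noiseLaw_flips_deviation {π γ : ℝ} (h0 : 0 ≤ π) (h1 : π ≤ 1) (hγ : 0 < γ) (k : ℕ) {N : ℕ}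
    (hN : 0 < N) :
    noiseLaw {u | γ * N < |(flips π k N u : ℝ) - π * N|} ≤ ENNReal.ofReal (1 / (γ ^ 2 * N)) := by
  have hmeas : ∀ i, Measurable fun u : ℕ → unitInterval => flipIndicator π (u (k + i)) :=
    fun i => (measurable_flipIndicator π).comp (measurable_pi_apply _)
  have hLp : ∀ i, MemLp (fun u : ℕ → unitInterval => flipIndicator π (u (k + i))) 2 noiseLaw :=
    fun i => memLp_of_bounded (a := 0) (b := 1) (ae_of_all _ fun u => flipIndicator_mem π _)
      (hmeas i).aestronglyMeasurable 2
  -- A crude variance bound is enough: these deviations only have to fall below a constant.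
  have hvar1 : ∀ i, ProbabilityTheory.variance
      (fun u : ℕ → unitInterval => flipIndicator π (u (k + i))) noiseLaw ≤ 1 := fun i => by
    refine (ProbabilityTheory.variance_le_sq_of_bounded
      (ae_of_all _ fun u => flipIndicator_mem π _) (hmeas i).aemeasurable).trans ?_
    norm_num
  set X : (ℕ → unitInterval) → ℝ :=
    ∑ i ∈ Finset.range N, fun u : ℕ → unitInterval => flipIndicator π (u (k + i)) with hX
  have hXeq : ∀ u, X u = flips π k N u := fun u => by
    rw [flips_eq_sum, hX, Finset.sum_apply]
  have hXLp : MemLp X 2 noiseLaw := memLp_finsetSum' _ fun i _ => hLp i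
  have hXvar : ProbabilityTheory.variance X noiseLaw ≤ N := by
    rw [hX, ProbabilityTheory.IndepFun.variance_sum (fun i _ => hLp i)
      (fun i _ j _ hij => (iIndepFun_noiseLaw (measurable_flipIndicator π) k).indepFun hij)]
    refine (Finset.sum_le_sum fun i _ => hvar1 i).trans ?_
    simp
  have hXmean : ∫ u, X u ∂noiseLaw = π * N := by
    simp only [hX, Finset.sum_apply]
    rw [integral_finsetSum _ fun i _ => (hLp i).integrable (by norm_num)]
    simp_rw [integral_flipIndicator h0 h1]
    simp [mul_comm]
  have hNpos : (0 : ℝ) < N := by exact_mod_cast hN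
  have hc : 0 < γ * N := by positivity
  calc noiseLaw {u | γ * N < |(flips π k N u : ℝ) - π * N|}
      ≤ noiseLaw {u | γ * N ≤ |X u - ∫ u, X u ∂noiseLaw|} := by
        rw [hXmean]
        refine measure_mono fun u hu => ?_
        simp only [mem_ofPred_eq, hXeq] at hu ⊢
        exact hu.le
    _ ≤ ENNReal.ofReal (ProbabilityTheory.variance X noiseLaw / (γ * N) ^ 2) :=
        ProbabilityTheory.meas_ge_le_variance_div_sq hXLp hc
    _ ≤ ENNReal.ofReal (1 / (γ ^ 2 * N)) := by
        refine ENNReal.ofReal_le_ofReal ?_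
        calc ProbabilityTheory.variance X noiseLaw / (γ * N) ^ 2 ≤ N / (γ * N) ^ 2 := by gcongr
          _ = 1 / (γ ^ 2 * N) := by field_simp

/-- The probability that the answers to queries missing the target look like those to queries
containing it, by comparison with a source in which zeros and ones are exchanged. -/
lemma noiseLaw_flips_ge {π γ : ℝ} (h0 : 0 < π) (h1 : π < 1 / 2) (k N : ℕ) :
    noiseLaw {u | (1 - π - γ) * N ≤ (flips π k N u : ℝ)} ≤
      ENNReal.ofReal (Real.exp (-(N * ((1 - 2 * π - 2 * γ) * Real.log ((1 - π) / π))))) := by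
  set ρ : ℝ := π / (1 - π) with hρ
  have h1' : 0 < 1 - π := by linarith
  have hρ0 : 0 < ρ := by positivity
  have hlog : Real.log ((1 - π) / π) = - Real.log ρ := by
    rw [hρ, ← Real.log_inv, inv_div]
  have hlogρ : Real.log ρ ≤ 0 := Real.log_nonpos hρ0.le (by rw [hρ, div_le_one h1']; linarith)
  -- Likelihood ratio of `Bern(1 - π)` to `Bern(π)`: it is `(1 - π) / π` on a flip and the inverse
  -- otherwise, and has mean one.
  let f : unitInterval → ℝ≥0∞ := fun x =>
    {x : unitInterval | (x : ℝ) < π}.indicator (fun _ => ENNReal.ofReal ρ⁻¹) x +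
      {x : unitInterval | (x : ℝ) < π}ᶜ.indicator (fun _ => ENNReal.ofReal ρ) x
  have hS := measurableSet_lt_unitInterval π
  have hf : Measurable f :=
    (measurable_const.indicator hS).add (measurable_const.indicator hS.compl)
  have hf1 : ∫⁻ x, f x = 1 := by
    have hm : Measurable fun x : unitInterval =>
        {x : unitInterval | (x : ℝ) < π}.indicator (fun _ => ENNReal.ofReal ρ⁻¹) x :=
      measurable_const.indicator hS
    simp only [f]
    rw [lintegral_add_left hm, lintegral_indicator_const hS, lintegral_indicator_const hS.compl,
      prob_compl_eq_one_sub hS, volume_lt_unitInterval (by linarith),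
      ← ENNReal.ofReal_one, ← ENNReal.ofReal_sub _ h0.le, ← ENNReal.ofReal_mul (by positivity),
      ← ENNReal.ofReal_mul hρ0.le, ← ENNReal.ofReal_add (by positivity) (by positivity)]
    congr 1
    rw [hρ]
    field_simp
    ring
  have hfval : ∀ (u : ℕ → unitInterval) n, f (u n) =
      ENNReal.ofReal (Real.exp ((1 - 2 * flipIndicator π (u n)) * Real.log ρ)) := fun u n => by
    by_cases h : (u n : ℝ) < π
    · have h' : u n ∈ {x : unitInterval | (x : ℝ) < π} := h
      simp only [f, flipIndicator, indicator_of_mem h', indicator_of_notMem (notMem_compl_iff.2 h'),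
        Pi.one_apply, add_zero]
      congr 1
      rw [show (1 - 2 * 1 : ℝ) * Real.log ρ = Real.log ρ⁻¹ by rw [Real.log_inv]; ring,
        Real.exp_log (by positivity)]
    · have h' : u n ∉ {x : unitInterval | (x : ℝ) < π} := h
      simp only [f, flipIndicator, indicator_of_notMem h', indicator_of_mem (mem_compl h'),
        zero_add]
      congr 1
      rw [show (1 - 2 * 0 : ℝ) * Real.log ρ = Real.log ρ by ring, Real.exp_log hρ0]
  have hprod : ∀ u : ℕ → unitInterval, ∏ i ∈ Finset.range N, f (u (k + i)) =
      ENNReal.ofReal (Real.exp ((N - 2 * flips π k N u) * Real.log ρ)) := fun u => by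
    simp_rw [hfval]
    rw [← ENNReal.ofReal_prod_of_nonneg fun _ _ => (Real.exp_pos _).le, ← Real.exp_sum,
      ← Finset.sum_mul, Finset.sum_sub_distrib, ← Finset.mul_sum, ← flips_eq_sum]
    simp
  have hint : ∫⁻ u, ∏ i ∈ Finset.range N, f (u (k + i)) ∂noiseLaw = 1 := by
    rw [ProbabilityTheory.lintegral_prod_eq_prod_lintegral_of_indepFun _
      (fun i (u : ℕ → unitInterval) => f (u (k + i))) (iIndepFun_noiseLaw hf k)
      (fun i => hf.comp (measurable_pi_apply _))]
    refine Finset.prod_eq_one fun i _ => ?_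
    rw [← lintegral_map (g := fun u : ℕ → unitInterval => u (k + i)) hf (by fun_prop),
      noiseLaw_map_eval, hf1]
  set c : ℝ := N * ((1 - 2 * π - 2 * γ) * Real.log ((1 - π) / π)) with hc
  have hmarkov := mul_meas_ge_le_lintegral (μ := noiseLaw)
    (f := fun u => ∏ i ∈ Finset.range N, f (u (k + i)))
    (Finset.measurable_prod _ fun i _ => hf.comp (measurable_pi_apply _))
    (ENNReal.ofReal (Real.exp c))
  rw [hint] at hmarkov
  have hsub : noiseLaw {u | (1 - π - γ) * N ≤ (flips π k N u : ℝ)} ≤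
      noiseLaw {u | ENNReal.ofReal (Real.exp c) ≤ ∏ i ∈ Finset.range N, f (u (k + i))} := by
    -- With `F` flips the product is `((1 - π) / π) ^ (2 * F - N)`, which is at least `exp c` once
    -- `F ≥ (1 - π - γ) * N`; Markov's inequality concludes.
    refine measure_mono fun u hu => ?_
    simp only [mem_ofPred_eq] at hu ⊢
    rw [hprod]
    refine ENNReal.ofReal_le_ofReal (Real.exp_le_exp.2 ?_)
    rw [hc, hlog]
    nlinarith
  refine hsub.trans ?_
  rw [Real.exp_neg, ENNReal.ofReal_inv_of_pos (Real.exp_pos _)]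
  rw [← one_div]
  refine (ENNReal.le_div_iff_mul_le (Or.inl ?_) (Or.inl ENNReal.ofReal_ne_top)).2 ?_
  · simpa using Real.exp_pos c
  · rwa [mul_comm]

/-- The noise variables are nonnegative and the comparison is strict. This settles false acceptance
in the noiseless case. -/
lemma flips_zero (k N : ℕ) (u : ℕ → unitInterval) : flips 0 k N u = 0 := by
  unfold flips flip
  rw [Finset.card_eq_zero, Finset.filter_eq_empty_iff]
  intro i _
  simpa using (u (k + i)).2.1

lemma measurable_flip (π : ℝ) (n : ℕ) : Measurable fun u : ℕ → unitInterval => flip π u n := by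
  refine measurable_to_bool ?_
  have : (fun u : ℕ → unitInterval => flip π u n) ⁻¹' {true} =
      {u : ℕ → unitInterval | (u n : ℝ) < π} := by ext; simp [flip]
  rw [this]
  exact measurableSet_lt (by fun_prop) measurable_const

/-! ## A random code with antipodal pairs of codewords -/

section RandomCode

variable {N M : ℕ} [NeZero M]

/-- Whether the cell `c < 2 * M` is probed by the query `h`: exactly one of the cells `j` and
`j + M` is, for each `j < M`. -/
def cellBit (h : Fin M → Bool) (c : ℕ) : Bool := xor (h (Fin.ofNat M c)) (decide (M ≤ c))

/-- Hamming distance between the codeword of the cell `c` and the observations `y`. -/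
def mismatch (g : Fin N → Fin M → Bool) (c : ℕ) (y : Fin N → Bool) : ℕ :=
  (Finset.univ.filter fun i => cellBit (g i) c ≠ y i).card

/-- Some codeword other than those of `c₀` and its antipode is within distance `r * N` of the
observations when the target is in the cell `c₀` and the flips are `z`. -/
def Confusable (r : ℝ) (g : Fin N → Fin M → Bool) (c₀ : ℕ) (z : Fin N → Bool) : Prop :=
  ∃ c < 2 * M, Fin.ofNat M c ≠ Fin.ofNat M c₀ ∧
    (mismatch g c (fun i => xor (cellBit (g i) c₀) (z i)) : ℝ) ≤ r * N

open Classical in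
/-- Threshold decoding: some cell whose codeword is within distance `r * N` of the observations. -/
def decode (r : ℝ) (g : Fin N → Fin M → Bool) (y : List Bool) : ℕ :=
  if h : ∃ c < 2 * M, (mismatch g c (fun i => y.getD i false) : ℝ) ≤ r * N then h.choose else 0

/-- The true codeword is within the threshold because there are few flips, and non-antipodal
competitors are excluded by assumption. Only the antipode remains, and its complementary codeword is
too far away. -/
lemma decode_eq {r : ℝ} (hr : r < 1 / 2) (hN : 0 < N) {g : Fin N → Fin M → Bool} {c₀ : ℕ}
    (hc₀ : c₀ < 2 * M) {z : Fin N → Bool}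
    (hz : ((Finset.univ.filter fun i => z i = true).card : ℝ) ≤ r * N)
    (hconf : ¬ Confusable r g c₀ z) {y : List Bool}
    (hy : ∀ i : Fin N, y.getD i false = xor (cellBit (g i) c₀) (z i)) : decode r g y = c₀ := by
  have hy' : (fun i : Fin N => y.getD i false) = fun i => xor (cellBit (g i) c₀) (z i) :=
    funext hy
  have h0 : mismatch g c₀ (fun i => xor (cellBit (g i) c₀) (z i)) =
      (Finset.univ.filter fun i => z i = true).card := by
    unfold mismatch
    congr 1
    ext i
    simp only [Finset.mem_filter, Finset.mem_univ, true_and]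
    generalize cellBit (g i) c₀ = a
    generalize z i = b
    revert a b
    decide
  have hex : ∃ c < 2 * M, (mismatch g c (fun i => y.getD i false) : ℝ) ≤ r * N :=
    ⟨c₀, hc₀, by rw [hy', h0]; exact hz⟩
  rw [decode, dif_pos hex]
  obtain ⟨hc, hmis⟩ := hex.choose_spec
  set c := hex.choose
  rw [hy'] at hmis
  by_contra hne
  have hmod : Fin.ofNat M c = Fin.ofNat M c₀ := by
    by_contra h
    exact hconf ⟨c, hc, h, hmis⟩
  have hmod' : c % M = c₀ % M := by simpa [Fin.ext_iff] using hmod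
  -- Two distinct cells below `2 * M` that agree modulo `M` lie in different halves, so they are
  -- antipodes.
  have hbit : decide (M ≤ c) ≠ decide (M ≤ c₀) := by
    intro h
    have hM : 0 < M := Nat.pos_of_neZero M
    apply hne
    have h1 := Nat.mod_add_div c M
    have h2 := Nat.mod_add_div c₀ M
    have key : ∀ x, x < 2 * M → x / M = if M ≤ x then 1 else 0 := fun x hx => by
      split_ifs with hle
      · exact Nat.div_eq_of_lt_le (by omega) (by omega)
      · exact Nat.div_eq_of_lt (by omega)
    rw [key c hc] at h1
    rw [key c₀ hc₀] at h2
    have h' : M ≤ c ↔ M ≤ c₀ := by simpa using h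
    simp only [h'] at h1
    omega
  -- The antipodal codeword disagrees exactly where there is no flip, in at least `(1 - r) * N > r *
  -- N` places.
  have hc1 : mismatch g c (fun i => xor (cellBit (g i) c₀) (z i)) =
      (Finset.univ.filter fun i => ¬ z i = true).card := by
    unfold mismatch cellBit
    congr 1
    ext i
    simp only [Finset.mem_filter, Finset.mem_univ, true_and, hmod]
    revert hbit
    generalize g i (Fin.ofNat M c₀) = a
    generalize z i = b
    generalize decide (M ≤ c) = d
    generalize decide (M ≤ c₀) = e
    revert a b d e
    decide
  have hsum := Finset.card_filter_add_card_filter_not (s := (Finset.univ : Finset (Fin N)))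
    (fun i => z i = true)
  rw [Finset.card_univ, Fintype.card_fin] at hsum
  have hsum' : ((Finset.univ.filter fun i => z i = true).card : ℝ) +
    (Finset.univ.filter fun i => ¬ z i = true).card = N := by exact_mod_cast hsum
  rw [hc1] at hmis
  have hNpos : (0 : ℝ) < N := by exact_mod_cast hN
  nlinarith

/-- The answers `0` and `1` are equally frequent at the coordinate `j`, whatever happens at another
coordinate. -/
lemma sum_pow_xor {m : ℕ} (x : ℝ) {j j₀ : Fin m} (hj : j ≠ j₀) (t : Bool → Bool) :
    ∑ h : Fin m → Bool, (if xor (h j) (t (h j₀)) = true then x else 1) =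
      Fintype.card (Fin m → Bool) * ((1 + x) / 2) := by
  -- Negating the bit `j` leaves the bit `j₀` alone and exchanges the two values, so the terms pair
  -- up with sum `1 + x`.
  let e : (Fin m → Bool) ≃ (Fin m → Bool) :=
    Function.Involutive.toPerm (fun h => Function.update h j (!(h j))) fun h => by simp
  have h1 := Equiv.sum_comp e fun h : Fin m → Bool => if xor (h j) (t (h j₀)) = true then x else 1
  have h2 : ∀ h : Fin m → Bool, (if xor (h j) (t (h j₀)) = true then x else 1) +
      (if xor (e h j) (t (e h j₀)) = true then x else 1) = 1 + x := fun h => by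
    have ha : e h j = !(h j) := Function.update_self ..
    have hb : e h j₀ = h j₀ := Function.update_of_ne hj.symm ..
    rw [ha, hb]
    cases h j <;> cases t (h j₀) <;> simp [add_comm]
  have h3 := Finset.sum_congr (rfl : (Finset.univ : Finset (Fin m → Bool)) = Finset.univ)
    fun h _ => h2 h
  rw [Finset.sum_add_distrib, h1, Finset.sum_const, Finset.card_univ, nsmul_eq_mul] at h3
  linarith

/-- Chernoff bound in counting form: for fixed noise, the mismatches at a non-antipodal cell are `N`
independent fair bits. -/
lemma card_mismatch_le {r : ℝ} (hr0 : 0 < r) (hr : r < 1 / 2) {c c₀ : ℕ}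
    (hc : Fin.ofNat M c ≠ Fin.ofNat M c₀) (z : Fin N → Bool) :
    ((Finset.univ.filter fun g : Fin N → Fin M → Bool =>
      (mismatch g c (fun i => xor (cellBit (g i) c₀) (z i)) : ℝ) ≤ r * N).card : ℝ) ≤
      Fintype.card (Fin N → Fin M → Bool) *
        Real.exp (-(N * (Real.log 2 - Real.binEntropy r))) := by
  have h1r : 0 < 1 - r := by linarith
  -- The minimizer of `((1 + x) / 2) * x ^ (-r)`, with minimum `exp (h(r) - log 2)`; `x ≤ 1` because
  -- `r < 1 / 2`.
  set x : ℝ := r / (1 - r) with hx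
  have hx0 : 0 < x := by positivity
  have hlogx : Real.log x ≤ 0 :=
    Real.log_nonpos hx0.le (by rw [hx, div_le_one h1r]; linarith)
  have hpow : ∀ g : Fin N → Fin M → Bool,
      x ^ mismatch g c (fun i => xor (cellBit (g i) c₀) (z i)) =
        ∏ i, (if xor (g i (Fin.ofNat M c)) (xor (decide (M ≤ c)) (xor (xor (g i (Fin.ofNat M c₀))
          (decide (M ≤ c₀))) (z i))) = true then x else 1) := fun g => by
    rw [Finset.prod_ite, Finset.prod_const_one, mul_one, Finset.prod_const]
    unfold mismatch cellBit
    congr 2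
    ext i
    simp only [Finset.mem_filter, Finset.mem_univ, true_and]
    generalize g i (Fin.ofNat M c) = a₁
    generalize g i (Fin.ofNat M c₀) = a
    generalize z i = b
    generalize decide (M ≤ c) = d
    generalize decide (M ≤ c₀) = e
    revert a₁ a b d e
    decide
  have hsum : ∑ g : Fin N → Fin M → Bool,
      x ^ mismatch g c (fun i => xor (cellBit (g i) c₀) (z i)) =
        Fintype.card (Fin N → Fin M → Bool) * ((1 + x) / 2) ^ N := by
    simp_rw [hpow]
    rw [← Fintype.piFinset_univ, ← Finset.prod_univ_sum (fun _ => Finset.univ)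
      (fun (i : Fin N) (h : Fin M → Bool) => if xor (h (Fin.ofNat M c)) (xor (decide (M ≤ c))
        (xor (xor (h (Fin.ofNat M c₀)) (decide (M ≤ c₀))) (z i))) = true then x else 1)]
    have : ∀ i : Fin N, ∑ h : Fin M → Bool, (if xor (h (Fin.ofNat M c)) (xor (decide (M ≤ c))
        (xor (xor (h (Fin.ofNat M c₀)) (decide (M ≤ c₀))) (z i))) = true then x else 1) =
        Fintype.card (Fin M → Bool) * ((1 + x) / 2) := fun i =>
      sum_pow_xor x hc fun b => xor (decide (M ≤ c)) (xor (xor b (decide (M ≤ c₀))) (z i))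
    rw [Finset.prod_congr rfl fun i _ => this i, Finset.prod_const, Finset.card_univ,
      Fintype.card_fin, mul_pow]
    congr 1
    rw [Fintype.card_fun (α := Fin N), Fintype.card_fin]
    push_cast
    rfl
  have hexp : Real.exp (-(N * (Real.log 2 - Real.binEntropy r))) =
      ((1 + x) / 2) ^ N * Real.exp (-(r * N * Real.log x)) := by
    have h12 : (1 + x) / 2 = (1 - r)⁻¹ * 2⁻¹ := by rw [hx]; field_simp; ring
    rw [← Real.exp_log (show 0 < ((1 + x) / 2) ^ N by positivity), ← Real.exp_add, Real.log_pow,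
      h12, Real.log_mul (by positivity) (by positivity), Real.log_inv, Real.log_inv, hx,
      Real.log_div hr0.ne' h1r.ne', Real.binEntropy, Real.log_inv, Real.log_inv]
    congr 1
    ring
  rw [hexp, ← mul_assoc, ← hsum, Real.exp_neg, ← div_eq_mul_inv, le_div_iff₀ (Real.exp_pos _)]
  calc _ = ∑ g ∈ Finset.univ.filter fun g : Fin N → Fin M → Bool =>
        (mismatch g c (fun i => xor (cellBit (g i) c₀) (z i)) : ℝ) ≤ r * N,
          Real.exp (r * N * Real.log x) := by rw [Finset.sum_const, nsmul_eq_mul]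
    _ ≤ ∑ g ∈ Finset.univ.filter fun g : Fin N → Fin M → Bool =>
        (mismatch g c (fun i => xor (cellBit (g i) c₀) (z i)) : ℝ) ≤ r * N,
          x ^ mismatch g c (fun i => xor (cellBit (g i) c₀) (z i)) := by
        refine Finset.sum_le_sum fun g hg => ?_
        have hg' := (Finset.mem_filter.1 hg).2
        rw [← Real.exp_log (pow_pos hx0 _), Real.log_pow]
        exact Real.exp_le_exp.2 (mul_le_mul_of_nonpos_right hg' hlogx)
    _ ≤ _ := Finset.sum_le_sum_of_subset_of_nonneg (Finset.filter_subset _ _)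
        fun g _ _ => (pow_pos hx0 _).le

/-- The uniform distribution on the codes with `N` queries and `2 * M` cells. -/
def codeLaw (N M : ℕ) : Measure (Fin N → Fin M → Bool) :=
  (PMF.uniformOfFintype (Fin N → Fin M → Bool)).toMeasure

instance : IsProbabilityMeasure (codeLaw N M) := by unfold codeLaw; infer_instance

/-- Union bound over the cells. The noise is a fixed word here, so only the randomness of the code
is used. -/
lemma codeLaw_confusable_le {r : ℝ} (hr0 : 0 < r) (hr : r < 1 / 2) (c₀ : ℕ) (z : Fin N → Bool) :
    codeLaw N M {g | Confusable r g c₀ z} ≤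
      ENNReal.ofReal (2 * M * Real.exp (-(N * (Real.log 2 - Real.binEntropy r)))) := by
  classical
  have hsub : {g : Fin N → Fin M → Bool | Confusable r g c₀ z} ⊆
      ⋃ c ∈ (Finset.range (2 * M)).filter fun c => Fin.ofNat M c ≠ Fin.ofNat M c₀,
        {g | (mismatch g c (fun i => xor (cellBit (g i) c₀) (z i)) : ℝ) ≤ r * N} := by
    rintro g ⟨c, hc, hne, hmis⟩
    simp only [mem_iUnion]
    exact ⟨c, Finset.mem_filter.2 ⟨Finset.mem_range.2 hc, hne⟩, hmis⟩
  have hone : ∀ c, Fin.ofNat M c ≠ Fin.ofNat M c₀ → codeLaw N M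
      {g | (mismatch g c (fun i => xor (cellBit (g i) c₀) (z i)) : ℝ) ≤ r * N} ≤
        ENNReal.ofReal (Real.exp (-(N * (Real.log 2 - Real.binEntropy r)))) := fun c hc => by
    rw [codeLaw, PMF.toMeasure_uniformOfFintype_apply _ (Set.toFinite _).measurableSet]
    refine ENNReal.div_le_of_le_mul ?_
    rw [← ENNReal.ofReal_natCast (Fintype.card (Fin N → Fin M → Bool)),
      ← ENNReal.ofReal_mul (Real.exp_pos _).le, ← ENNReal.ofReal_natCast]
    refine ENNReal.ofReal_le_ofReal ?_
    rw [mul_comm (Real.exp _)]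
    refine le_trans (le_of_eq ?_) (card_mismatch_le hr0 hr hc z)
    norm_cast
    rw [Fintype.card_subtype]
    rfl
  calc codeLaw N M {g | Confusable r g c₀ z}
      ≤ ∑ c ∈ (Finset.range (2 * M)).filter fun c => Fin.ofNat M c ≠ Fin.ofNat M c₀,
          codeLaw N M {g | (mismatch g c (fun i => xor (cellBit (g i) c₀) (z i)) : ℝ) ≤ r * N} :=
        (measure_mono hsub).trans (measure_biUnion_finset_le _ _)
    _ ≤ ∑ c ∈ (Finset.range (2 * M)).filter fun c => Fin.ofNat M c ≠ Fin.ofNat M c₀,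
          ENNReal.ofReal (Real.exp (-(N * (Real.log 2 - Real.binEntropy r)))) :=
        Finset.sum_le_sum fun c hc => hone c (Finset.mem_filter.1 hc).2
    _ ≤ ∑ _c ∈ Finset.range (2 * M),
          ENNReal.ofReal (Real.exp (-(N * (Real.log 2 - Real.binEntropy r)))) :=
        Finset.sum_le_sum_of_subset (Finset.filter_subset _ _)
    _ = _ := by
        rw [Finset.sum_const, Finset.card_range, nsmul_eq_mul, ← ENNReal.ofReal_natCast,
          ← ENNReal.ofReal_mul (by positivity)]
        push_cast
        rfl

end RandomCode

/-! ## Partition of an arc into cells -/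

section ArcCells

variable {M : ℕ} [NeZero M]

/-- The position of `x` in the arc of size `L` centered at `a`, measured from its left end. -/
def arcCoord (L : ℝ) (a x : UnitAddCircle) : ℝ :=
  (AddCircle.equivIoc (1 : ℝ) 0 (x - a + ((L / 2 : ℝ) : UnitAddCircle)) : ℝ)

/-- The index of the cell containing the point `t` of `(0, L]`, divided into `2 * M` cells. -/
def lineCell (M : ℕ) (L t : ℝ) : ℕ := ⌈t * (2 * M) / L⌉₊ - 1

/-- The points of `(0, L]` whose cells are probed by the query `h`. -/
def lineQuery (L : ℝ) (h : Fin M → Bool) : Set ℝ :=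
  {t | t ∈ Ioc 0 L ∧ cellBit h (lineCell M L t) = true}

/-- The part of the arc of size `L` centered at `a` probed by the query `h`. -/
def arcQuery (L : ℝ) (h : Fin M → Bool) (a : UnitAddCircle) : Set UnitAddCircle :=
  {x | arcCoord L a x ∈ lineQuery L h}

/-- The center of the cell `c` of the arc of size `L` centered at `a`. -/
def cellCenter (M : ℕ) (L : ℝ) (a : UnitAddCircle) (c : ℕ) : UnitAddCircle :=
  a + (((c + 1 / 2) * (L / (2 * M)) - L / 2 : ℝ) : UnitAddCircle)

lemma measurableSet_lineQuery (L : ℝ) (h : Fin M → Bool) : MeasurableSet (lineQuery L h) := by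
  have h1 : Measurable fun t : ℝ => cellBit h (lineCell M L t) := by
    unfold lineCell
    exact (measurable_of_countable fun n : ℕ => cellBit h (n - 1)).comp
      (Nat.measurable_ceil.comp (by fun_prop))
  exact measurableSet_Ioc.inter (h1 (measurableSet_singleton true))

lemma measurable_arcCoord (L : ℝ) :
    Measurable fun z : UnitAddCircle × UnitAddCircle => arcCoord L z.1 z.2 := by
  have h1 : Measurable (AddCircle.equivIoc (1 : ℝ) 0) :=
    (AddCircle.measurableEquivIoc (1 : ℝ) 0).measurable
  have h2 : Measurable fun z : UnitAddCircle × UnitAddCircle =>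
      z.2 - z.1 + ((L / 2 : ℝ) : UnitAddCircle) := by fun_prop
  exact measurable_subtype_coe.comp (h1.comp h2)

lemma lineCell_lt {L t : ℝ} (hL : 0 < L) (ht : t ∈ Ioc 0 L) : lineCell M L t < 2 * M := by
  have hM : 0 < M := Nat.pos_of_neZero M
  have : ⌈t * (2 * M) / L⌉₊ ≤ 2 * M := by
    rw [Nat.ceil_le, div_le_iff₀ hL]
    push_cast
    nlinarith [ht.2, show (0 : ℝ) < 2 * M by positivity]
  unfold lineCell
  omega

/-- With the ceiling convention, cell `c` is the interval `(c * w, (c + 1) * w]` of width `w = L /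
(2 * M)`, which matches the half-open `Ioc 0 L`. -/
lemma lineCell_spec {L t : ℝ} (hL : 0 < L) (ht : t ∈ Ioc 0 L) :
    |t - (lineCell M L t + 1 / 2) * (L / (2 * M))| ≤ L / (2 * M) / 2 := by
  have hM : (0 : ℝ) < 2 * M := by
    have := Nat.pos_of_neZero M
    positivity
  have hw : 0 < L / (2 * M) := by positivity
  have hpos : 0 < t * (2 * M) / L := by have := ht.1; positivity
  have h1 : 0 < ⌈t * (2 * M) / L⌉₊ := Nat.ceil_pos.2 hpos
  have h2 : ((lineCell M L t : ℕ) : ℝ) = ⌈t * (2 * M) / L⌉₊ - 1 := by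
    unfold lineCell
    rw [Nat.cast_sub h1]
    simp
  have h3 := Nat.le_ceil (t * (2 * M) / L)
  have h4 := Nat.ceil_lt_add_one hpos.le
  have hM0 : (M : ℝ) ≠ 0 := by exact_mod_cast NeZero.ne M
  have ht' : t = t * (2 * M) / L * (L / (2 * M)) := by field_simp
  rw [h2]
  set n : ℝ := (⌈t * (2 * M) / L⌉₊ : ℝ)
  set w := L / (2 * M)
  rw [ht', abs_le]
  constructor <;> nlinarith

lemma lineCell_add_half {L t : ℝ} (hL : 0 < L) (ht : 0 < t) :
    lineCell M L (t + L / 2) = lineCell M L t + M := by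
  have hM : 0 < M := Nat.pos_of_neZero M
  have hpos : 0 < t * (2 * M) / L := by positivity
  have h1 : 0 < ⌈t * (2 * M) / L⌉₊ := Nat.ceil_pos.2 hpos
  have : (t + L / 2) * (2 * M) / L = t * (2 * M) / L + M := by field_simp
  unfold lineCell
  rw [this, Nat.ceil_add_natCast hpos.le]
  omega

lemma cellBit_add (h : Fin M → Bool) {c : ℕ} (hc : c < M) :
    cellBit h (c + M) = !cellBit h c := by
  unfold cellBit
  have h1 : Fin.ofNat M (c + M) = Fin.ofNat M c := by simp [Fin.ext_iff]
  rw [h1, decide_eq_true (show M ≤ c + M by omega), decide_eq_false (show ¬ M ≤ c by omega)]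
  simp

/-- Translation by `L / 2` exchanges antipodal cells, so the right half of the query is the
translate of the complement of its left half. The two pieces have total length `L / 2` for every
`h`, which makes the noise level the same for all queries. -/
lemma volume_lineQuery {L : ℝ} (hL : 0 < L) (h : Fin M → Bool) :
    volume (lineQuery L h) = ENNReal.ofReal (L / 2) := by
  have hQ := measurableSet_lineQuery L h
  have hsplit : lineQuery L h = (Ioc 0 (L / 2) ∩ lineQuery L h) ∪
      (fun t => t + -(L / 2)) ⁻¹' (Ioc 0 (L / 2) \ lineQuery L h) := by
    have key : ∀ t ∈ Ioc 0 (L / 2), (t + L / 2 ∈ lineQuery L h ↔ t ∉ lineQuery L h) := by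
      intro t ht
      have hcell : lineCell M L t < M := by
        have hM : 0 < M := Nat.pos_of_neZero M
        have : ⌈t * (2 * M) / L⌉₊ ≤ M := by
          rw [Nat.ceil_le, div_le_iff₀ hL]
          nlinarith [ht.2, show (0 : ℝ) < M by positivity]
        unfold lineCell
        omega
      have m1 : t + L / 2 ∈ Ioc 0 L := ⟨by linarith [ht.1], by linarith [ht.2]⟩
      have m2 : t ∈ Ioc 0 L := ⟨ht.1, by linarith [ht.2]⟩
      simp only [lineQuery, mem_ofPred_eq, m1, m2, true_and, lineCell_add_half hL ht.1,
        cellBit_add h hcell]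
      simp
    ext t
    simp only [mem_union, mem_inter_iff, mem_preimage, Set.mem_sdiff]
    constructor
    · intro ht
      rcases le_or_gt t (L / 2) with hle | hlt
      · exact Or.inl ⟨⟨ht.1.1, hle⟩, ht⟩
      · have m : t + -(L / 2) ∈ Ioc 0 (L / 2) := ⟨by linarith, by linarith [ht.1.2]⟩
        refine Or.inr ⟨m, (key _ m).1 ?_⟩
        simpa using ht
    · rintro (⟨_, ht⟩ | ⟨m, ht⟩)
      · exact ht
      · simpa using (key _ m).2 ht
  have hdisj : Disjoint (Ioc 0 (L / 2) ∩ lineQuery L h)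
      ((fun t => t + -(L / 2)) ⁻¹' (Ioc 0 (L / 2) \ lineQuery L h)) := by
    rw [Set.disjoint_left]
    rintro t ⟨ht, _⟩ ⟨ht', _⟩
    linarith [ht.2, ht'.1]
  have hm : MeasurableSet (Ioc 0 (L / 2) \ lineQuery L h) := measurableSet_Ioc.diff hQ
  rw [hsplit, measure_union hdisj (hm.preimage (measurable_id.add_const _)),
    measure_preimage_add_right, measure_inter_add_sdiff _ hQ, Real.volume_Ioc, sub_zero]

lemma volume_arcQuery {L : ℝ} (hL : 0 < L) (hL1 : L ≤ 1) (h : Fin M → Bool) (a : UnitAddCircle) :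
    volume (arcQuery L h a) = ENNReal.ofReal (L / 2) := by
  have hA := measurableSet_lineQuery L h
  have h1 : arcQuery L h a = (fun x => x + (-a + ((L / 2 : ℝ) : UnitAddCircle))) ⁻¹'
      (AddCircle.equivIoc (1 : ℝ) 0 ⁻¹' (Subtype.val ⁻¹' lineQuery L h)) := by
    ext x
    simp only [arcQuery, arcCoord, mem_ofPred_eq, mem_preimage, sub_eq_add_neg, add_assoc]
  rw [h1, measure_preimage_add_right, (AddCircle.measurePreserving_equivIoc (T := 1)
    (a := 0)).measure_preimage (hA.preimage measurable_subtype_coe).nullMeasurableSet,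
    Measure.comap_apply _ Subtype.val_injective
      (fun s hs => measurableSet_Ioc.subtype_image hs) _ (hA.preimage measurable_subtype_coe),
    Subtype.image_preimage_coe, ← volume_lineQuery hL h]
  congr 1
  refine inter_eq_right.2 fun t ht => ⟨ht.1.1, by linarith [ht.1.2]⟩

lemma coe_arcCoord (L : ℝ) (a x : UnitAddCircle) :
    ((arcCoord L a x : ℝ) : UnitAddCircle) = x - a + ((L / 2 : ℝ) : UnitAddCircle) :=
  AddCircle.coe_equivIoc

lemma norm_coe_le (t : ℝ) : ‖(t : UnitAddCircle)‖ ≤ |t| :=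
  QuotientAddGroup.norm_mk_le_norm

lemma arcQuery_subset (L : ℝ) (h : Fin M → Bool) (a : UnitAddCircle) :
    arcQuery L h a ⊆ Metric.closedBall a (L / 2) := by
  intro x hx
  have ht := hx.1
  have hx' : x - a = ((arcCoord L a x - L / 2 : ℝ) : UnitAddCircle) := by
    rw [AddCircle.coe_sub, coe_arcCoord]
    abel
  rw [Metric.mem_closedBall, dist_eq_norm, hx']
  refine (norm_coe_le _).trans (abs_le.2 ⟨by linarith [ht.1], by linarith [ht.2]⟩)

lemma dist_cellCenter_le {L : ℝ} (hL : 0 < L) {a x : UnitAddCircle}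
    (hx : arcCoord L a x ∈ Ioc 0 L) :
    dist x (cellCenter M L a (lineCell M L (arcCoord L a x))) ≤ L / (2 * M) / 2 := by
  have hx' : x - cellCenter M L a (lineCell M L (arcCoord L a x)) =
      ((arcCoord L a x - (lineCell M L (arcCoord L a x) + 1 / 2) * (L / (2 * M)) : ℝ) :
        UnitAddCircle) := by
    rw [cellCenter, AddCircle.coe_sub, AddCircle.coe_sub, coe_arcCoord]
    abel
  rw [dist_eq_norm, hx']
  exact (norm_coe_le _).trans (lineCell_spec hL hx)

/-- The margin `L / 4`, rather than `L / 2`, keeps the target away from the left end, which `Ioc 0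
L` excludes. -/
lemma arcCoord_mem {L : ℝ} (hL : 0 < L) (hL1 : L ≤ 1) {a x : UnitAddCircle}
    (hx : dist x a ≤ L / 4) : arcCoord L a x ∈ Ioc 0 L := by
  -- The representative in `(-1/2, 1/2]`, whose absolute value is the cyclic distance.
  let y := AddCircle.equivIoc (1 : ℝ) (-(1 / 2)) (x - a)
  have hy : ((y : ℝ) : UnitAddCircle) = x - a := AddCircle.coe_equivIoc
  have hy2 := y.2
  have hynorm : |(y : ℝ)| = dist x a := by
    rw [dist_eq_norm, ← hy]
    refine ((AddCircle.norm_coe_eq_abs_iff (1 : ℝ) one_ne_zero).2 ?_).symm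
    rw [abs_one, abs_le]
    exact ⟨by linarith [hy2.1], by linarith [hy2.2]⟩
  have hy3 := abs_le.1 (hynorm.le.trans hx)
  have hcoord : arcCoord L a x = y + L / 2 := by
    rw [arcCoord, ← hy, ← AddCircle.coe_add, AddCircle.equivIoc_coe_of_mem]
    exact ⟨by linarith, by linarith⟩
  rw [hcoord]
  exact ⟨by linarith, by linarith⟩

lemma arcCoord_one_mem (a x : UnitAddCircle) : arcCoord 1 a x ∈ Ioc (0 : ℝ) 1 := by
  have := (AddCircle.equivIoc (1 : ℝ) 0 (x - a + ((1 / 2 : ℝ) : UnitAddCircle))).2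
  exact ⟨this.1, this.2.trans (zero_add (1 : ℝ)).le⟩

open Classical in
lemma decide_mem_arcQuery {L : ℝ} {a x : UnitAddCircle} (hx : arcCoord L a x ∈ Ioc 0 L)
    (h : Fin M → Bool) :
    decide (x ∈ arcQuery L h a) = cellBit h (lineCell M L (arcCoord L a x)) := by
  have : x ∈ arcQuery L h a ↔ cellBit h (lineCell M L (arcCoord L a x)) = true :=
    ⟨fun h => h.2, fun h => ⟨hx, h⟩⟩
  simp [this]

end ArcCells

/-! ## Two-phase search with random codes -/

lemma measurableSet_prod_of_countable {A B : Type*} [MeasurableSpace A] [MeasurableSpace B]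
    [Countable A] [MeasurableSingletonClass A] {P : A → B → Prop}
    (h : ∀ a, MeasurableSet {b | P a b}) : MeasurableSet {z : A × B | P z.1 z.2} := by
  have : Measurable fun z : A × B => P z.1 z.2 :=
    measurable_from_prod_countable_right fun a => measurableSet_setOfPred.1 (h a)
  exact measurableSet_setOfPred.2 this

/-- The query at time `k` of the code `g`. -/
def codeAt {N M : ℕ} (g : Fin N → Fin M → Bool) (k : ℕ) : Fin M → Bool :=
  if h : k < N then g ⟨k, h⟩ else fun _ => false

lemma measurable_arcCoord_right (L : ℝ) (a : UnitAddCircle) : Measurable (arcCoord L a) :=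
  (measurable_arcCoord L).comp measurable_prodMk_left

lemma measurable_cellCenter (M : ℕ) (L : ℝ) (c : ℕ) : Measurable fun a => cellCenter M L a c := by
  unfold cellCenter
  fun_prop

/-- The scheme whose coarse and zoomed-in searches use random codes with `2 * Mc` and `2 * Mz` cells
and threshold decoding. -/
def randomScheme {α δ : ℝ} (hα0 : 0 < α) (hα : α ≤ 1 / 2) (hδ : δ ≤ 1 / 2) (Nc Nz Nv Mc Mz : ℕ)
    [NeZero Mc] [NeZero Mz] (hNv : 0 < Nv) (rc rz tol : ℝ) (htol : 0 < tol) :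
    TwoPhaseScheme α δ where
  α_le := hα
  δ_le := hδ
  Seed := (Fin Nc → Fin Mc → Bool) × (Fin Nz → Fin Mz → Bool)
  law := (codeLaw Nc Mc).prod (codeLaw Nz Mz)
  coarseLen := Nc
  zoomLen := Nz
  validLen := Nv
  validLen_pos := hNv
  coarseQuery s k := arcQuery 1 (codeAt s.1 k) 0
  measurableSet_coarseQuery k := measurableSet_prod_of_countable
    (P := fun (s : (Fin Nc → Fin Mc → Bool) × (Fin Nz → Fin Mz → Bool)) x =>
      x ∈ arcQuery 1 (codeAt s.1 k) 0)
    fun s => measurable_arcCoord_right 1 0 (measurableSet_lineQuery 1 _)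
  volume_coarseQuery_le s k := by
    rw [volume_arcQuery one_pos le_rfl, ENNReal.ofReal_div_of_pos two_pos]
    simp
  coarseEst s y := cellCenter Mc 1 0 (decode rc s.1 y)
  measurable_coarseEst y := measurable_of_countable _
  zoomQuery s a k := arcQuery α (codeAt s.2 k) a
  measurableSet_zoomQuery k := by
    have h := measurableSet_prod_of_countable
      (P := fun (s : (Fin Nc → Fin Mc → Bool) × (Fin Nz → Fin Mz → Bool))
        (z : UnitAddCircle × UnitAddCircle) => z.2 ∈ arcQuery α (codeAt s.2 k) z.1)
      fun s => measurable_arcCoord α (measurableSet_lineQuery α _)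
    have h' : Measurable fun z : (((Fin Nc → Fin Mc → Bool) × (Fin Nz → Fin Mz → Bool)) ×
        UnitAddCircle) × UnitAddCircle => (z.1.1, (z.1.2, z.2)) := by fun_prop
    exact h' h
  zoomQuery_subset s a k := arcQuery_subset α _ a
  volume_zoomQuery_le s a k := (volume_arcQuery hα0 (by linarith) _ a).le
  zoomEst s a y := cellCenter Mz α a (decode rz s.2 y)
  measurable_zoomEst y := measurable_from_prod_countable_right fun s =>
    measurable_cellCenter Mz α (decode rz s.2 y)
  tol := tol
  tol_pos := htol

lemma crossover_of_pos (p : ℝ → ℝ) {q : ℝ} (hq : 0 < q) : crossover p q = p q := if_pos hq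

lemma card_filter_flip (π : ℝ) (u : ℕ → unitInterval) (k N : ℕ) :
    (Finset.univ.filter fun i : Fin N => flip π u (k + i) = true).card = flips π k N u := by
  rw [flips, Finset.card_filter, Finset.card_filter,
    Fin.sum_univ_eq_sum_range (fun i => if flip π u (k + i) = true then 1 else 0)]

lemma count_map_range (f : ℕ → Bool) (N : ℕ) :
    ((List.range N).map f).count true = ((Finset.range N).filter fun i => f i = true).card := by
  induction N with
  | zero => rfl
  | succ N ih =>
    rw [List.range_succ, List.map_append, List.count_append, ih, Finset.range_add_one,
      Finset.filter_insert]
    by_cases h : f N = true <;> simp [h]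

/-! ### Correct decoding from few flips and no confusable codeword -/

section Code

variable {N M : ℕ} [NeZero M] {p : ℝ → ℝ} {L : ℝ} {a w₀ : UnitAddCircle}

/-- All queries have measure `L / 2`, so an answer is a codeword bit plus a flip whose law depends
neither on the code nor on the target. -/
lemma answer_arcQuery (hL : 0 < L) (hL1 : L ≤ 1) (hw : arcCoord L a w₀ ∈ Ioc 0 L)
    (h : Fin M → Bool) (u : ℕ → unitInterval) (n : ℕ) :
    TwoPhaseScheme.answer p w₀ (arcQuery L h a) (u n) =
      xor (cellBit h (lineCell M L (arcCoord L a w₀))) (flip (p (L / 2)) u n) := by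
  have hvol : volume.real (arcQuery L h a) = L / 2 := by
    rw [Measure.real, volume_arcQuery hL hL1, ENNReal.toReal_ofReal (by linarith)]
  rw [TwoPhaseScheme.answer, hvol, crossover_of_pos p (by linarith), decide_mem_arcQuery hw]
  rfl

/-- Decoding finds the right cell if there are not too many flips and no confusable codeword. -/
lemma dist_decode_le (hL : 0 < L) (hL1 : L ≤ 1) (hw : arcCoord L a w₀ ∈ Ioc 0 L) {r : ℝ}
    (hr : r < 1 / 2) (hN : 0 < N) (g : Fin N → Fin M → Bool) (u : ℕ → unitInterval) (k : ℕ)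
    (hflips : (flips (p (L / 2)) k N u : ℝ) ≤ r * N)
    (hconf : ¬ Confusable r g (lineCell M L (arcCoord L a w₀))
      fun i => flip (p (L / 2)) u (k + i)) :
    dist w₀ (cellCenter M L a (decode r g ((List.range N).map fun i =>
      TwoPhaseScheme.answer p w₀ (arcQuery L (codeAt g i) a) (u (k + i))))) ≤ L / (2 * M) / 2 := by
  rw [decode_eq hr hN (lineCell_lt hL hw) (by rw [card_filter_flip]; exact hflips) hconf]
  · exact dist_cellCenter_le hL hw
  · intro i
    have hi := i.2
    rw [List.getD_eq_getElem _ _ (by simp)]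
    simp only [List.getElem_map, List.getElem_range]
    rw [answer_arcQuery hL hL1 hw, codeAt, dif_pos hi]

end Code

/-! ### Validation outcomes in terms of flips -/

namespace TwoPhaseScheme

variable {α δ : ℝ} (S : TwoPhaseScheme α δ) (p : ℝ → ℝ) (w₀ : UnitAddCircle)

lemma measurable_coarseObs (s : S.Seed) :
    @Measurable _ _ _ ⊤ fun u : ℕ → unitInterval => S.coarseObs p w₀ s u := by
  have h := S.measurable_roundObs p w₀ s S.coarseLen
  have h' : (fun u => S.roundObs p w₀ s u S.coarseLen) = fun u => S.coarseObs p w₀ s u :=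
    funext fun u => S.roundObs_coarse p w₀ s u _ le_rfl
  rwa [h'] at h

open Classical in
-- Every validation query has measure `δ`: ones are non-flips if the interval contains the target,
-- and flips otherwise.
lemma count_validObs (hδ0 : 0 < δ) (s : S.Seed) (u : ℕ → unitInterval) :
    (((S.validObs p w₀ s u).count true : ℕ) : ℝ) =
      if w₀ ∈ Metric.closedBall (S.zoomResult p w₀ s u) (δ / 2) then
        (S.validLen : ℝ) - flips (p δ) (S.coarseLen + S.zoomLen) S.validLen u
      else (flips (p δ) (S.coarseLen + S.zoomLen) S.validLen u : ℝ) := by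
  have hvol : ∀ f : UnitAddCircle, volume.real (Metric.closedBall f (δ / 2)) = δ := fun f => by
    rw [Measure.real, AddCircle.volume_closedBall, min_eq_right (by linarith [S.δ_le]),
      ENNReal.toReal_ofReal (by linarith)]
    ring
  rw [validObs, count_map_range]
  simp only [answer, hvol, crossover_of_pos p hδ0]
  split_ifs with h
  · have hsum := Finset.card_filter_add_card_filter_not (s := Finset.range S.validLen)
      (fun i => flip (p δ) u (S.coarseLen + S.zoomLen + i) = true)
    rw [Finset.card_range] at hsum
    have hsum' : (flips (p δ) (S.coarseLen + S.zoomLen) S.validLen u : ℝ) +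
        ((Finset.range S.validLen).filter fun i =>
          ¬ flip (p δ) u (S.coarseLen + S.zoomLen + i) = true).card = S.validLen := by
      exact_mod_cast hsum
    rw [← hsum', add_sub_cancel_left]
    congr 3
    ext i
    simp [h, flip]
  · congr 3
    ext i
    simp [h, flip]

lemma measure_noise_event (B : Set (ℕ → unitInterval)) :
    (S.law.prod noiseLaw) {z | z.2 ∈ B} = noiseLaw B := by
  have : {z : S.Seed × (ℕ → unitInterval) | z.2 ∈ B} = univ ×ˢ B := by ext; simp
  rw [this, Measure.prod_prod, measure_univ, one_mul]

/-- A round that found the target is rejected only if the validation noise is atypical, which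
Chebyshev's inequality bounds. -/
lemma measure_reject_le (hδ0 : 0 < δ) (hp0 : 0 ≤ p δ) (hp1 : p δ ≤ 1) :
    (S.law.prod noiseLaw) (S.acceptEvent p w₀)ᶜ ≤ (S.law.prod noiseLaw) (S.missEvent p w₀) +
      ENNReal.ofReal (1 / (S.tol ^ 2 * S.validLen)) := by
  have hsub : (S.acceptEvent p w₀)ᶜ ⊆ S.missEvent p w₀ ∪ {z | z.2 ∈ {u | S.tol * S.validLen <
      |(flips (p δ) (S.coarseLen + S.zoomLen) S.validLen u : ℝ) - p δ * S.validLen|}} := by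
    intro z hz
    by_cases hm : z ∈ S.missEvent p w₀
    · exact Or.inl hm
    · right
      rw [mem_compl_iff, mem_acceptEvent_iff, not_le, S.count_validObs p w₀ hδ0] at hz
      rw [mem_missEvent_iff, not_not] at hm
      rw [if_pos hm] at hz
      refine hz.trans_eq ?_
      rw [← abs_neg]
      congr 1
      ring
  refine (measure_mono hsub).trans ((measure_union_le _ _).trans ?_)
  rw [measure_noise_event]
  gcongr
  exact noiseLaw_flips_deviation hp0 hp1 S.tol_pos _ S.validLen_pos

/-- Accepting a wrong interval forces an excess of flips, an event of the noise alone; no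
independence from the earlier phases is needed. -/
lemma measure_false_accept_le (hδ0 : 0 < δ) :
    (S.law.prod noiseLaw) (S.acceptEvent p w₀ ∩ S.missEvent p w₀) ≤
      noiseLaw {u | (1 - p δ - S.tol) * S.validLen ≤
        (flips (p δ) (S.coarseLen + S.zoomLen) S.validLen u : ℝ)} := by
  rw [← S.measure_noise_event]
  refine measure_mono fun z hz => ?_
  obtain ⟨ha, hm⟩ := hz
  rw [mem_acceptEvent_iff, S.count_validObs p w₀ hδ0] at ha
  rw [mem_missEvent_iff] at hm
  rw [if_neg hm] at ha
  have := (abs_le.1 ha).1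
  change (1 - p δ - S.tol) * S.validLen ≤
    (flips (p δ) (S.coarseLen + S.zoomLen) S.validLen z.2 : ℝ)
  linarith

end TwoPhaseScheme

/-! ### Averaging over the random codes with the noise fixed -/

section RandomCodes

variable {Nc Nz Mc Mz : ℕ} {rc rz : ℝ}


lemma measure_coarse_confusable_le [NeZero Mc] (hrc0 : 0 < rc) (hrc : rc < 1 / 2) (π : ℝ) (c : ℕ) :
    (((codeLaw Nc Mc).prod (codeLaw Nz Mz)).prod noiseLaw)
      {z | Confusable rc z.1.1 c fun i => flip π z.2 (0 + i)} ≤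
      ENNReal.ofReal (2 * Mc * Real.exp (-(Nc * (Real.log 2 - Real.binEntropy rc)))) := by
  have hmeas : MeasurableSet {z : ((Fin Nc → Fin Mc → Bool) × (Fin Nz → Fin Mz → Bool)) ×
      (ℕ → unitInterval) | Confusable rc z.1.1 c fun i => flip π z.2 (0 + i)} := by
    refine measurableSet_prod_of_countable (A := (Fin Nc → Fin Mc → Bool) ×
      (Fin Nz → Fin Mz → Bool)) (P := fun s u => Confusable rc s.1 c fun i => flip π u (0 + i))
      fun s => ?_
    have h : Measurable fun (u : ℕ → unitInterval) (i : Fin Nc) => flip π u (0 + i) :=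
      measurable_pi_lambda _ fun i => measurable_flip π _
    exact h (Set.toFinite {z | Confusable rc s.1 c z}).measurableSet
  rw [Measure.prod_apply_symm hmeas]
  refine (lintegral_mono (g := fun _ => ENNReal.ofReal (2 * Mc * Real.exp (-(Nc * (Real.log 2 -
    Real.binEntropy rc))))) fun u => ?_).trans (by simp)
  have : (fun s : (Fin Nc → Fin Mc → Bool) × (Fin Nz → Fin Mz → Bool) => (s, u)) ⁻¹'
      {z | Confusable rc z.1.1 c fun i => flip π z.2 (0 + i)} =
      {g | Confusable rc g c fun i => flip π u (0 + i)} ×ˢ univ := by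
    ext; simp
  rw [this, Measure.prod_prod, measure_univ, mul_one]
  exact codeLaw_confusable_le hrc0 hrc c _

/-- The target's cell in the coarse interval depends on the coarse code and the noise, but not on
the zoom code. Conditionally on the first two it is a fixed cell, and the random coding bound
applies. -/
lemma measure_zoom_confusable_le [NeZero Mz] (hrz0 : 0 < rz) (hrz : rz < 1 / 2) (π : ℝ) (k : ℕ)
    (c : (Fin Nc → Fin Mc → Bool) → (ℕ → unitInterval) → ℕ) (hc : ∀ g, Measurable (c g)) :
    (((codeLaw Nc Mc).prod (codeLaw Nz Mz)).prod noiseLaw)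
      {z | Confusable rz z.1.2 (c z.1.1 z.2) fun i => flip π z.2 (k + i)} ≤
      ENNReal.ofReal (2 * Mz * Real.exp (-(Nz * (Real.log 2 - Real.binEntropy rz)))) := by
  have hmeas : MeasurableSet {z : ((Fin Nc → Fin Mc → Bool) × (Fin Nz → Fin Mz → Bool)) ×
      (ℕ → unitInterval) | Confusable rz z.1.2 (c z.1.1 z.2) fun i => flip π z.2 (k + i)} := by
    refine measurableSet_prod_of_countable (A := (Fin Nc → Fin Mc → Bool) ×
      (Fin Nz → Fin Mz → Bool)) (P := fun s u => Confusable rz s.2 (c s.1 u) fun i =>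
        flip π u (k + i)) fun s => ?_
    have h : Measurable fun u : ℕ → unitInterval =>
        (c s.1 u, fun i : Fin Nz => flip π u (k + i)) :=
      (hc s.1).prodMk (measurable_pi_lambda _ fun i => measurable_flip π _)
    exact h (Set.to_countable {x : ℕ × (Fin Nz → Bool) | Confusable rz s.2 x.1 x.2}).measurableSet
  rw [Measure.prod_apply_symm hmeas]
  refine (lintegral_mono (g := fun _ => ENNReal.ofReal (2 * Mz * Real.exp (-(Nz * (Real.log 2 -
    Real.binEntropy rz))))) fun u => ?_).trans (by simp)
  let E : Set ((Fin Nc → Fin Mc → Bool) × (Fin Nz → Fin Mz → Bool)) :=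
    {s | Confusable rz s.2 (c s.1 u) fun i => flip π u (k + i)}
  have hE : MeasurableSet E := (Set.to_countable E).measurableSet
  change ((codeLaw Nc Mc).prod (codeLaw Nz Mz)) E ≤ _
  rw [Measure.prod_apply hE]
  refine (lintegral_mono (g := fun _ => ENNReal.ofReal (2 * Mz * Real.exp (-(Nz * (Real.log 2 -
    Real.binEntropy rz))))) fun g => ?_).trans (by simp)
  exact codeLaw_confusable_le hrz0 hrz (c g u) _

end RandomCodes

section RandomScheme

variable {α δ : ℝ} (hα0 : 0 < α) (hα : α ≤ 1 / 2) (hδ : δ ≤ 1 / 2) (Nc Nz Nv Mc Mz : ℕ)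
    [NeZero Mc] [NeZero Mz] (hNv : 0 < Nv) (rc rz tol : ℝ) (htol : 0 < tol)

instance : Countable (randomScheme hα0 hα hδ Nc Nz Nv Mc Mz hNv rc rz tol htol).Seed :=
  inferInstanceAs (Countable ((Fin Nc → Fin Mc → Bool) × (Fin Nz → Fin Mz → Bool)))

instance : MeasurableSingletonClass
    (randomScheme hα0 hα hδ Nc Nz Nv Mc Mz hNv rc rz tol htol).Seed :=
  inferInstanceAs (MeasurableSingletonClass
    ((Fin Nc → Fin Mc → Bool) × (Fin Nz → Fin Mz → Bool)))

variable {Nc Nz Mc Mz}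

/-- Probability that the interval found in a round misses the target. -/
lemma randomScheme_measure_miss_le (p : ℝ → ℝ) (w₀ : UnitAddCircle) {γc γz : ℝ} (hγc : 0 < γc)
    (hγz : 0 < γz) (hpc : 0 ≤ p (1 / 2)) (hpz : 0 ≤ p (α / 2)) (hrc : p (1 / 2) + γc < 1 / 2)
    (hrz : p (α / 2) + γz < 1 / 2) (hNc : 0 < Nc) (hNz : 0 < Nz) (hMc : 1 ≤ α * Mc)
    (hMz : α ≤ δ * (2 * Mz)) :
    ((randomScheme hα0 hα hδ Nc Nz Nv Mc Mz hNv (p (1 / 2) + γc) (p (α / 2) + γz) tol htol).law.prod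
        noiseLaw) ((randomScheme hα0 hα hδ Nc Nz Nv Mc Mz hNv (p (1 / 2) + γc) (p (α / 2) + γz)
          tol htol).missEvent p w₀) ≤
      ENNReal.ofReal (1 / (γc ^ 2 * Nc)) + ENNReal.ofReal (2 * Mc * Real.exp (-(Nc * (Real.log 2 -
        Real.binEntropy (p (1 / 2) + γc))))) +
      (ENNReal.ofReal (1 / (γz ^ 2 * Nz)) + ENNReal.ofReal (2 * Mz * Real.exp (-(Nz * (Real.log 2 -
        Real.binEntropy (p (α / 2) + γz)))))) := by
  set S := randomScheme hα0 hα hδ Nc Nz Nv Mc Mz hNv (p (1 / 2) + γc) (p (α / 2) + γz) tol htol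
  let cc := lineCell Mc 1 (arcCoord 1 0 w₀)
  let A (g : Fin Nc → Fin Mc → Bool) (u : ℕ → unitInterval) : UnitAddCircle :=
    cellCenter Mc 1 0 (decode (p (1 / 2) + γc) g ((List.range Nc).map fun i =>
      TwoPhaseScheme.answer p w₀ (arcQuery 1 (codeAt g i) 0) (u (0 + i))))
  let cz (g : Fin Nc → Fin Mc → Bool) (u : ℕ → unitInterval) : ℕ :=
    lineCell Mz α (arcCoord α (A g u) w₀)
  have hcz : ∀ g, Measurable (cz g) := fun g => by
    let : MeasurableSpace (List Bool) := ⊤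
    -- The coarse observations ignore the zoom code, so any value can be put there.
    have h1 := S.measurable_coarseObs p w₀ (g, fun _ _ => false)
    have h2 : Measurable fun y : List Bool => lineCell Mz α (arcCoord α
        (cellCenter Mc 1 0 (decode (p (1 / 2) + γc) g y)) w₀) := measurable_of_countable _
    have h3 := h2.comp h1
    convert h3 using 1
    funext u
    simp only [cz, A, zero_add]
    rfl
  let B1 : Set (S.Seed × (ℕ → unitInterval)) := {z | z.2 ∈ {u : ℕ → unitInterval |
    γc * Nc < |(flips (p (1 / 2)) 0 Nc u : ℝ) - p (1 / 2) * Nc|}}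
  let B2 : Set (((Fin Nc → Fin Mc → Bool) × (Fin Nz → Fin Mz → Bool)) × (ℕ → unitInterval)) :=
    {z | Confusable (p (1 / 2) + γc) z.1.1 cc fun i => flip (p (1 / 2)) z.2 (0 + i)}
  let B3 : Set (S.Seed × (ℕ → unitInterval)) := {z | z.2 ∈ {u : ℕ → unitInterval |
    γz * Nz < |(flips (p (α / 2)) Nc Nz u : ℝ) - p (α / 2) * Nz|}}
  let B4 : Set (((Fin Nc → Fin Mc → Bool) × (Fin Nz → Fin Mz → Bool)) × (ℕ → unitInterval)) :=
    {z | Confusable (p (α / 2) + γz) z.1.2 (cz z.1.1 z.2) fun i => flip (p (α / 2)) z.2 (Nc + i)}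
  have hsub : S.missEvent p w₀ ⊆ (B1 ∪ B2) ∪ (B3 ∪ B4) := by
    rintro ⟨s, u⟩ hmiss
    rw [TwoPhaseScheme.mem_missEvent_iff] at hmiss
    by_contra hgood
    have h1 : (s, u) ∉ B1 := fun h => hgood (Or.inl (Or.inl h))
    have h2 : (s, u) ∉ B2 := fun h => hgood (Or.inl (Or.inr h))
    have h3 : (s, u) ∉ B3 := fun h => hgood (Or.inr (Or.inl h))
    have h4 : (s, u) ∉ B4 := fun h => hgood (Or.inr (Or.inr h))
    apply hmiss
    have h1' : |(flips (p (1 / 2)) 0 Nc u : ℝ) - p (1 / 2) * Nc| ≤ γc * Nc := not_lt.1 h1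
    have h3' : |(flips (p (α / 2)) Nc Nz u : ℝ) - p (α / 2) * Nz| ≤ γz * Nz := not_lt.1 h3
    have hMc0 : (0 : ℝ) < Mc := by exact_mod_cast Nat.pos_of_neZero Mc
    have hMz0 : (0 : ℝ) < Mz := by exact_mod_cast Nat.pos_of_neZero Mz
    -- Half a coarse cell is `1 / (4 * Mc) ≤ α / 4`, the margin required by `arcCoord_mem`.
    have hcoarse : dist w₀ (A s.1 u) ≤ α / 4 := by
      refine (dist_decode_le one_pos le_rfl (arcCoord_one_mem 0 w₀) hrc hNc s.1 u 0
        (by linarith [(abs_le.1 h1').2]) h2).trans ?_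
      rw [div_div, div_le_iff₀ (by positivity)]
      linarith
    have hzoom := dist_decode_le hα0 (by linarith) (arcCoord_mem hα0 (by linarith) hcoarse) hrz hNz
      s.2 u Nc (by linarith [(abs_le.1 h3').2]) h4
    rw [Metric.mem_closedBall]
    have hA : A s.1 u = S.coarseResult p w₀ s u := by
      simp only [A, zero_add]
      rfl
    rw [hA] at hzoom
    refine le_trans hzoom ?_
    rw [div_le_div_iff_of_pos_right two_pos, div_le_iff₀ (by positivity)]
    exact hMz
  refine (measure_mono hsub).trans ((measure_union_le _ _).trans (add_le_add
    ((measure_union_le _ _).trans (add_le_add ?_ ?_))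
    ((measure_union_le _ _).trans (add_le_add ?_ ?_))))
  · exact (S.measure_noise_event _).trans_le
      (noiseLaw_flips_deviation hpc (by linarith) hγc 0 hNc)
  · exact measure_coarse_confusable_le (by linarith) hrc _ _
  · exact (S.measure_noise_event _).trans_le
      (noiseLaw_flips_deviation hpz (by linarith) hγz Nc hNz)
  · exact measure_zoom_confusable_le (by linarith) hrz _ _ cz hcz

end RandomScheme

/-! ## Choice of the parameters -/

/-- The output entropy is at most `log 2`. This direction suffices, since the capacity is a
denominator in an upper bound. -/
lemma capacity_le (p : ℝ) : capacity p ≤ Real.log 2 - Real.binEntropy p := by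
  have : Nonempty (Icc (0 : ℝ) 1) := ⟨⟨0, by simp⟩⟩
  refine ciSup_le fun q => ?_
  unfold mutualInfo
  linarith [Real.binEntropy_le_log_two (p := q * (1 - p) + (1 - q) * p)]

lemma binEntropy_lt {r : ℝ} (hr : r < 1 / 2) : Real.binEntropy r < Real.log 2 :=
  Real.binEntropy_lt_log_two.2 (by rw [← one_div]; exact hr.ne)

lemma capacityOne_zero : capacityOne 0 = ⊤ := by
  simp [capacityOne, relEntropy]

lemma capacityOne_of_pos {π : ℝ} (h0 : 0 < π) (h1 : π < 1 / 2) :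
    capacityOne π = ENNReal.ofReal ((1 - 2 * π) * Real.log ((1 - π) / π)) := by
  have h1' : 0 < 1 - π := by linarith
  have hne : ¬ ((1 - π = 0 ∧ π ≠ 0) ∨ (1 - π = 1 ∧ π ≠ 1)) := by
    rintro (⟨h, _⟩ | ⟨h, _⟩) <;> linarith
  rw [capacityOne, relEntropy, if_neg hne]
  congr 1
  rw [show 1 - (1 - π) = π by ring, Real.log_div h1'.ne' h0.ne', Real.log_div h0.ne' h1'.ne']
  ring

lemma exists_coarse_length {γ H C κ : ℝ} (hγ : 0 < γ) (hH : 0 < H) (hκ : 0 < κ) :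
    ∃ N : ℕ, 0 < N ∧ 1 / (γ ^ 2 * N) ≤ κ ∧ C * Real.exp (-(N * H)) ≤ κ := by
  have hN : Tendsto (fun N : ℕ => (N : ℝ)) atTop atTop := tendsto_natCast_atTop_atTop
  have h1 : Tendsto (fun N : ℕ => 1 / (γ ^ 2 * (N : ℝ))) atTop (𝓝 0) :=
    tendsto_const_nhds.div_atTop (hN.const_mul_atTop (by positivity))
  have h2 : Tendsto (fun N : ℕ => C * Real.exp (-((N : ℝ) * H))) atTop (𝓝 (C * 0)) :=
    (Real.tendsto_exp_neg_atTop_nhds_zero.comp (hN.atTop_mul_const hH)).const_mul C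
  rw [mul_zero] at h2
  obtain ⟨N, ha, hb, hc⟩ := ((eventually_gt_atTop 0).and ((h1.eventually_le_const hκ).and
    (h2.eventually_le_const hκ))).exists
  exact ⟨N, ha, hb, hc⟩

/-- Continuity of the entropy at `γ = 0`: a threshold slightly above the crossover costs at most a
factor `1 + θ` in the rate. -/
lemma exists_margin {π₀ π₁ θ : ℝ} (h0 : 0 ≤ π₀) (h01 : π₀ ≤ π₁) (h1 : π₁ < 1 / 2) (hθ : 0 < θ) :
    ∃ γ : ℝ, 0 < γ ∧ π₀ + γ < 1 / 2 ∧ (Real.log 2 - Real.binEntropy π₁) / (1 + θ) ≤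
      Real.log 2 - Real.binEntropy (π₀ + γ) := by
  have hD : 0 < Real.log 2 - Real.binEntropy π₁ := by linarith [binEntropy_lt h1]
  have hmono : Real.binEntropy π₀ ≤ Real.binEntropy π₁ :=
    Real.binEntropy_strictMonoOn.monotoneOn ⟨h0, by norm_num; linarith⟩
      ⟨by linarith, by norm_num; linarith⟩ h01
  have hlt : (Real.log 2 - Real.binEntropy π₁) / (1 + θ) <
      Real.log 2 - Real.binEntropy (π₀ + 0) := by
    rw [div_lt_iff₀ (by linarith), add_zero]
    nlinarith
  have hcont : Tendsto (fun γ : ℝ => Real.log 2 - Real.binEntropy (π₀ + γ)) (𝓝[>] 0)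
      (𝓝 (Real.log 2 - Real.binEntropy (π₀ + 0))) :=
    ((continuous_const.sub (Real.binEntropy_continuous.comp
      (continuous_const.add continuous_id))).tendsto 0).mono_left nhdsWithin_le_nhds
  have hsmall : ∀ᶠ γ : ℝ in 𝓝[>] 0, γ < 1 / 2 - π₀ :=
    nhdsWithin_le_nhds (eventually_lt_nhds (by linarith))
  obtain ⟨γ, ha, hb, hc⟩ := ((hcont.eventually_const_le hlt).and
    (hsmall.and self_mem_nhdsWithin)).exists
  exact ⟨γ, hc, by linarith, ha⟩

/-- About `1 / δ` cells are needed, hence `log (1 / δ)` divided by the error exponent many queries.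
The margin `γ` and the constant `K` are chosen before `δ`. -/
lemma exists_zoom_length {π₀ π₁ θ κ : ℝ} (h0 : 0 ≤ π₀) (h01 : π₀ ≤ π₁) (h1 : π₁ < 1 / 2)
    (hθ : 0 < θ) (hκ : 0 < κ) :
    ∃ γ K : ℝ, 0 < γ ∧ π₀ + γ < 1 / 2 ∧ ∀ δ ∈ Ioo (0 : ℝ) (1 / 2), ∃ N M : ℕ, 0 < N ∧ 0 < M ∧
      1 ≤ δ * (2 * M) ∧ 1 / (γ ^ 2 * N) ≤ κ ∧
      2 * M * Real.exp (-(N * (Real.log 2 - Real.binEntropy (π₀ + γ)))) ≤ κ ∧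
      N ≤ (1 + θ) * (Real.log (1 / δ) / (Real.log 2 - Real.binEntropy π₁)) + K := by
  obtain ⟨γ, hγ, hγ2, hD'⟩ := exists_margin h0 h01 h1 hθ
  have hD : 0 < Real.log 2 - Real.binEntropy π₁ := by linarith [binEntropy_lt h1]
  set D := Real.log 2 - Real.binEntropy π₁
  set E := D / (1 + θ) with hE
  have hE0 : 0 < E := by positivity
  -- `K₁` extra queries take care of Chebyshev's bound; with `C = 0` the exponential condition is
  -- void.
  obtain ⟨K₁, hK₁, hK₁', -⟩ := exists_coarse_length (C := 0) hγ one_pos hκ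
  refine ⟨γ, (Real.log 2 + |Real.log κ|) / E + 1 + K₁, hγ, hγ2, fun δ hδ => ?_⟩
  have hδ0 := hδ.1
  set M := ⌈1 / (2 * δ)⌉₊ with hM
  have hM0 : 0 < M := Nat.ceil_pos.2 (by positivity)
  have hMle : 1 / (2 * δ) ≤ M := Nat.le_ceil _
  have hMlt : (M : ℝ) < 1 / (2 * δ) + 1 := Nat.ceil_lt_add_one (by positivity)
  have hMR : (0 : ℝ) < M := by exact_mod_cast hM0
  have hlogM : Real.log (2 * M) ≤ Real.log 2 + Real.log (1 / δ) := by
    rw [← Real.log_mul two_ne_zero (by positivity)]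
    refine Real.log_le_log (by positivity) ?_
    have h3 : 1 / (2 * δ) = 1 / δ / 2 := by field_simp
    have h4 : 2 ≤ 1 / δ := by
      rw [le_div_iff₀ hδ0]
      linarith [hδ.2]
    linarith
  have hlogδ : 0 ≤ Real.log (1 / δ) := Real.log_nonneg (by
    rw [le_div_iff₀ hδ0]
    linarith [hδ.2])
  -- Solves `2 * M * exp (-t * E) = exp (-|log κ|) ≤ κ`; the absolute value keeps `t` nonnegative.
  set t := (Real.log (2 * M) + |Real.log κ|) / E with ht
  have ht0 : 0 ≤ t := by
    have hM1 : (1 : ℝ) ≤ M := by exact_mod_cast hM0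
    have : 0 ≤ Real.log (2 * M) := Real.log_nonneg (by linarith)
    positivity
  have hN1 : t ≤ ⌈t⌉₊ := Nat.le_ceil t
  have hN2 : (⌈t⌉₊ : ℝ) < t + 1 := Nat.ceil_lt_add_one ht0
  have hK₁R : (0 : ℝ) < K₁ := by exact_mod_cast hK₁
  refine ⟨⌈t⌉₊ + K₁, M, by omega, hM0, ?_, ?_, ?_, ?_⟩
  · rw [div_le_iff₀ (by positivity)] at hMle
    linarith
  · refine le_trans ?_ hK₁'
    push_cast
    gcongr
    linarith [Nat.cast_nonneg (α := ℝ) ⌈t⌉₊]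
  · have h5 : t * E ≤ ((⌈t⌉₊ + K₁ : ℕ) : ℝ) * (Real.log 2 - Real.binEntropy (π₀ + γ)) := by
      push_cast
      have : t ≤ (⌈t⌉₊ : ℝ) + K₁ := by linarith
      nlinarith
    have h6 : t * E = Real.log (2 * M) + |Real.log κ| := by
      rw [ht]
      field_simp
    calc _ ≤ 2 * M * Real.exp (-(t * E)) := by gcongr
      _ = Real.exp (-|Real.log κ|) := by
        rw [h6, neg_add, Real.exp_add, Real.exp_neg, Real.exp_log (by positivity)]
        field_simp
      _ ≤ Real.exp (Real.log κ) := Real.exp_le_exp.2 (neg_abs_le _)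
      _ = κ := Real.exp_log hκ
  · push_cast
    have h7 : t ≤ (1 + θ) * (Real.log (1 / δ) / D) + (Real.log 2 + |Real.log κ|) / E := by
      have : (1 + θ) * (Real.log (1 / δ) / D) = Real.log (1 / δ) / E := by
        rw [hE]
        field_simp
      rw [this, ← add_div, ht]
      refine div_le_div_of_nonneg_right ?_ hE0.le
      linarith
    linarith

/-- `tol` and `K` must be uniform in the crossover `π`, because `p δ` varies with `δ`; the bound `π
≤ P < 1 / 2` permits this. The real number `x` stands for `log (1 / ε) / C₁(π)`, equal to `0` when
`C₁` is infinite. -/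
lemma exists_validation_length {P θ κ ρ : ℝ} (hP : P < 1 / 2) (hP0 : 0 ≤ P) (hθ : 0 < θ)
    (hκ : 0 < κ) (hρ : 0 < ρ) (hρ1 : ρ ≤ 1) :
    ∃ tol K : ℝ, 0 < tol ∧ ∀ π ∈ Icc 0 P, ∀ ε ∈ Ioo (0 : ℝ) 1, ∃ (N : ℕ) (x : ℝ), 0 < N ∧ 0 ≤ x ∧
      ENNReal.ofReal x = ENNReal.ofReal (Real.log (1 / ε)) / capacityOne π ∧
      1 / (tol ^ 2 * N) ≤ κ ∧
      (∀ k, noiseLaw {u | (1 - π - tol) * N ≤ (flips π k N u : ℝ)} ≤ ENNReal.ofReal (ε * ρ)) ∧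
      N ≤ (1 + θ) * x + K := by
  -- Chosen so that `2 * tol ≤ (1 - 2 * π) * θ / (1 + θ)` for all `π ≤ P`: the tolerance then lowers
  -- the exponent `C₁(π)` by at most the factor `1 + θ`.
  set tol := (1 - 2 * P) * θ / (2 * (1 + θ)) with htol
  have hP2 : 0 < 1 - 2 * P := by linarith
  have htol0 : 0 < tol := by positivity
  have htol1 : 2 * tol = (1 - 2 * P) * (θ / (1 + θ)) := by
    rw [htol]
    field_simp
  have hθ1 : θ / (1 + θ) < 1 := by
    rw [div_lt_one (by linarith)]
    linarith
  obtain ⟨K₂, hK₂, hK₂', -⟩ := exists_coarse_length (C := 0) htol0 one_pos hκ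
  have hK₂R : (0 : ℝ) < K₂ := by exact_mod_cast hK₂
  -- `C₁` decreases in the crossover, so this is its least value on `(0, P]`. For `P = 0` the
  -- convention for division by zero gives `cmin = 0`, which is harmless since then `π = 0`.
  set cmin := (1 - 2 * P) * Real.log ((1 - P) / P) with hcmin
  have hlogρ : 0 ≤ - Real.log ρ := by linarith [Real.log_nonpos hρ.le hρ1]
  have hcmin0 : 0 ≤ cmin := by
    rcases hP0.eq_or_lt with h | h
    · rw [hcmin, ← h]
      simp
    · refine mul_nonneg hP2.le (Real.log_nonneg ?_)
      rw [le_div_iff₀ h]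
      linarith
  refine ⟨tol, -Real.log ρ * (1 + θ) / cmin + 1 + K₂, htol0, fun π hπ ε hε => ?_⟩
  have hlogε : 0 ≤ Real.log (1 / ε) := Real.log_nonneg (by
    rw [le_div_iff₀ hε.1]
    linarith [hε.2])
  -- For `π = 0` there are no flips and `tol < 1`, so a wrong interval is never accepted, and a
  -- constant number of queries is enough.
  rcases hπ.1.eq_or_lt with h | h
  · refine ⟨K₂, 0, hK₂, le_rfl, ?_, hK₂', fun k => ?_, ?_⟩
    · rw [← h, capacityOne_zero, ENNReal.div_top, ENNReal.ofReal_zero]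
    · rw [← h]
      have : {u : ℕ → unitInterval | (1 - 0 - tol) * K₂ ≤ (flips 0 k K₂ u : ℝ)} = ∅ := by
        ext u
        simp only [flips_zero, mem_ofPred_eq, mem_empty_iff_false, iff_false, not_le,
          Nat.cast_zero]
        have : tol < 1 := by nlinarith
        exact mul_pos (by linarith) hK₂R
      rw [this, measure_empty]
      exact zero_le
    · have : 0 ≤ -Real.log ρ * (1 + θ) / cmin := by positivity
      linarith
  · have hπ2 : 0 < 1 - 2 * π := by linarith [hπ.2]
    have hP0' : 0 < P := h.trans_le hπ.2
    have hπ1 : π < 1 / 2 := by linarith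
    have hlogP : 0 < Real.log ((1 - P) / P) := Real.log_pos (by
      rw [lt_div_iff₀ hP0']
      linarith)
    have hlog : Real.log ((1 - P) / P) ≤ Real.log ((1 - π) / π) := by
      refine Real.log_le_log (div_pos (by linarith) hP0') ?_
      exact div_le_div₀ (by linarith) (by linarith [hπ.2]) h hπ.2
    have hcmin0' : 0 < cmin := by positivity
    set ℓ := Real.log ((1 - π) / π) with hℓ
    have hℓ0 : 0 < ℓ := hlogP.trans_le hlog
    set c := (1 - 2 * π) * ℓ with hc
    have hcc : cmin ≤ c := mul_le_mul (by linarith [hπ.2]) hlog hlogP.le hπ2.le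
    have hc0 : 0 < c := hcmin0'.trans_le hcc
    -- Solves `exp (-t * c / (1 + θ)) = ε * ρ`.
    set t := (Real.log (1 / ε) - Real.log ρ) * (1 + θ) / c with ht
    have ht0 : 0 ≤ t := div_nonneg (mul_nonneg (by linarith) (by linarith)) hc0.le
    have hN1 : t ≤ ⌈t⌉₊ := Nat.le_ceil t
    have hN2 : (⌈t⌉₊ : ℝ) < t + 1 := Nat.ceil_lt_add_one ht0
    refine ⟨⌈t⌉₊ + K₂, Real.log (1 / ε) / c, by omega, by positivity, ?_, ?_, fun k => ?_, ?_⟩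
    · rw [capacityOne_of_pos h hπ1, ENNReal.ofReal_div_of_pos hc0]
    · refine le_trans ?_ hK₂'
      push_cast
      gcongr
      linarith [Nat.cast_nonneg (α := ℝ) ⌈t⌉₊]
    · refine (noiseLaw_flips_ge h hπ1 k _).trans (ENNReal.ofReal_le_ofReal ?_)
      have h8 : c / (1 + θ) ≤ (1 - 2 * π - 2 * tol) * ℓ := by
        have h9 : c / (1 + θ) = (1 - 2 * π) * (1 - θ / (1 + θ)) * ℓ := by
          rw [hc]
          field_simp
          ring
        rw [h9]
        have h10 : (1 - 2 * P) * (θ / (1 + θ)) ≤ (1 - 2 * π) * (θ / (1 + θ)) := by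
          have := hπ.2
          gcongr
        refine mul_le_mul_of_nonneg_right ?_ hℓ0.le
        linarith
      have h11 : t * (c / (1 + θ)) = Real.log (1 / ε) - Real.log ρ := by
        rw [ht]
        field_simp
      have h12 : t * (c / (1 + θ)) ≤
          ((⌈t⌉₊ + K₂ : ℕ) : ℝ) * ((1 - 2 * π - 2 * tol) * ℓ) := by
        push_cast
        refine mul_le_mul (by linarith) h8 (by positivity) (by positivity)
      calc _ ≤ Real.exp (-(Real.log (1 / ε) - Real.log ρ)) :=
            Real.exp_le_exp.2 (by linarith)
        _ = ε * ρ := by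
          rw [one_div, Real.log_inv, show -(-Real.log ε - Real.log ρ) = Real.log ε + Real.log ρ
            by ring, Real.exp_add, Real.exp_log hε.1, Real.exp_log hρ]
    · push_cast
      have h13 : t = (1 + θ) * (Real.log (1 / ε) / c) + -Real.log ρ * (1 + θ) / c := by
        rw [ht]
        field_simp
        ring
      have h14 : -Real.log ρ * (1 + θ) / c ≤ -Real.log ρ * (1 + θ) / cmin := by
        gcongr
      linarith

/-- The scheme `S` achieves the resolution `δ`, the error probability `ε`, and the expected stopping
time of two-phase search with validation up to the factor `1 + η`. -/
def AchievesUpTo (p : ℝ → ℝ) (qstar : ℝ) {α δ : ℝ} (ε η : ℝ) (S : TwoPhaseScheme α δ) : Prop :=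
  ∀ v : UnitAddCircle, (S.toStrategy p v).HasResolution p v δ ε ∧
    ∀ w₀ : UnitAddCircle, (S.toStrategy p v).expectedTime p w₀ v ≤
      (ENNReal.ofReal (Real.log (1 / α)) / ENNReal.ofReal (capacity (p qstar)) +
        ENNReal.ofReal (Real.log (1 / δ)) / ENNReal.ofReal (capacity (p α)) +
        ENNReal.ofReal (Real.log (1 / ε)) / capacityOne (p δ)) * ENNReal.ofReal (1 + η)

/-- For a fixed `η`, all small resolutions and error probabilities are achieved up to the factor
`1 + η`, by schemes with a fixed tolerance. -/
lemma exists_achievesUpTo {p : ℝ → ℝ} (hp : IsNoiseFunction p) (qstar : ℝ) {α : ℝ}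
    (hα : α ∈ Ioo (0 : ℝ) (1 / 2)) {η : ℝ} (hη : 0 < η) :
    ∃ δ₁ > 0, ∀ δ ∈ Ioo (0 : ℝ) δ₁, ∀ ε ∈ Ioo (0 : ℝ) 1,
      ∃ S : TwoPhaseScheme α δ, AchievesUpTo p qstar ε η S := by
  obtain ⟨hα0, hα2⟩ := hα
  -- The loss is `1 + 2 * θ` in the length of a round and `1 + θ` for the restarts; with `θ ≤ 1` the
  -- product is at most `1 + 5 * θ`.
  set θ := min η 1 / 5 with hθ
  have hθ0 : 0 < θ := by positivity
  have hθη : 5 * θ ≤ η := by rw [hθ]; linarith [min_le_left η 1]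
  have hθ1 : 5 * θ ≤ 1 := by rw [hθ]; linarith [min_le_right η 1]
  have hfac : (1 + 2 * θ) * (1 + θ) ≤ 1 + η := by nlinarith
  -- probability of rejecting a round
  set κ := θ / (1 + θ) / 5 with hκ
  have hκ0 : 0 < κ := by positivity
  -- Five events can spoil a round, each of probability at most `κ`: too many flips or a confusable
  -- codeword in either search, and atypical validation noise.
  have h5κ : 1 - 5 * κ = 1 / (1 + θ) := by
    rw [hκ]
    field_simp
    ring
  have hρ0 : 0 < 1 - 5 * κ := by rw [h5κ]; positivity
  have hmem : ∀ q ∈ Ioc (0 : ℝ) (1 / 2), 0 ≤ p q ∧ p q < 1 / 2 := fun q hq => hp.mem_Ico q hq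
  obtain ⟨hc0, hc2⟩ := hmem (1 / 2) ⟨by norm_num, le_rfl⟩
  obtain ⟨hz0, hz2⟩ := hmem (α / 2) ⟨by linarith, by linarith⟩
  obtain ⟨ha0, ha2⟩ := hmem α ⟨hα0, hα2.le⟩
  have hza : p (α / 2) ≤ p α :=
    hp.monotoneOn ⟨by linarith, by linarith⟩ ⟨hα0, hα2.le⟩ (by linarith)
  set D := Real.log 2 - Real.binEntropy (p α) with hD
  have hD0 : 0 < D := by linarith [binEntropy_lt ha2]
  -- coarse search
  set γc := (1 / 2 - p (1 / 2)) / 2 with hγc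
  have hγc0 : 0 < γc := by linarith
  have hrc : p (1 / 2) + γc < 1 / 2 := by linarith
  set Mc := ⌈1 / α⌉₊ with hMc
  have hMc0 : 0 < Mc := Nat.ceil_pos.2 (by positivity)
  have hMcα : 1 ≤ α * Mc := by
    have := Nat.le_ceil (1 / α)
    rw [div_le_iff₀ hα0] at this
    linarith
  obtain ⟨Nc, hNc, hNc1, hNc2⟩ := exists_coarse_length (C := 2 * Mc) hγc0
    (sub_pos.2 (binEntropy_lt hrc)) hκ0
  -- zoomed-in search and validation
  obtain ⟨γz, Kz, hγz, hrz, hzoom⟩ := exists_zoom_length hz0 hza ha2 hθ0 hκ0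
  obtain ⟨tol, Kv, htol, hvalid⟩ := exists_validation_length hc2 hc0 hθ0 hκ0 hρ0 (by linarith)
  set K := Nc + Kz + Kv with hK
  -- Below this bound on `δ`, the constant `K` of the three phases is at most `θ * log (1 / δ) / D`.
  refine ⟨min (1 / 2) (Real.exp (-(K * D / θ))), by positivity, fun δ hδ ε hε => ?_⟩
  have hδ0 := hδ.1
  have hδ2 : δ < 1 / 2 := hδ.2.trans_le (min_le_left _ _)
  have hδK : K ≤ θ * (Real.log (1 / δ) / D) := by
    have h1 : Real.log δ ≤ -(K * D / θ) := by
      rw [← Real.log_exp (-(K * D / θ))]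
      exact Real.log_le_log hδ0 (hδ.2.le.trans (min_le_right _ _))
    have h2 : K * D / θ ≤ Real.log (1 / δ) := by
      rw [one_div, Real.log_inv]
      linarith
    rw [div_le_iff₀ hθ0] at h2
    rw [← mul_div_assoc, le_div_iff₀ hD0]
    linarith
  have hpδ : p δ ∈ Icc 0 (p (1 / 2)) :=
    ⟨(hmem δ ⟨hδ0, hδ2.le⟩).1, hp.monotoneOn ⟨hδ0, hδ2.le⟩ ⟨by norm_num, le_rfl⟩ hδ2.le⟩
  obtain ⟨Nz, Mz, hNz, hMz0, hMz, hNz1, hNz2, hNz3⟩ := hzoom δ ⟨hδ0, hδ2⟩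
  obtain ⟨Nv, x, hNv, hx0, hx, hNv1, hNv2, hNv3⟩ := hvalid (p δ) hpδ ε hε
  have : NeZero Mc := ⟨hMc0.ne'⟩
  have : NeZero Mz := ⟨hMz0.ne'⟩
  obtain ⟨S, _, _, hlen, hStol, hSv, hmiss⟩ : ∃ S : TwoPhaseScheme α δ, Countable S.Seed ∧
      MeasurableSingletonClass S.Seed ∧ S.roundLen = Nc + Nz + Nv ∧ S.tol = tol ∧
      S.validLen = Nv ∧ ∀ w₀, (S.law.prod noiseLaw) (S.missEvent p w₀) ≤ ENNReal.ofReal (4 * κ) := by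
    refine ⟨randomScheme hα0 hα2.le hδ2.le Nc Nz Nv Mc Mz hNv (p (1 / 2) + γc) (p (α / 2) + γz) tol
      htol, inferInstance, inferInstance, rfl, rfl, rfl, fun w₀ => ?_⟩
    refine (randomScheme_measure_miss_le hα0 hα2.le hδ2.le Nv hNv tol htol p w₀ hγc0 hγz hc0 hz0
      hrc hrz hNc hNz hMcα (by linarith)).trans ?_
    rw [show 4 * κ = κ + κ + (κ + κ) by ring, ENNReal.ofReal_add (by positivity) (by positivity),
      ENNReal.ofReal_add hκ0.le hκ0.le]
    gcongr
  have hreject : ∀ w₀, (S.law.prod noiseLaw) (S.acceptEvent p w₀)ᶜ ≤ ENNReal.ofReal (5 * κ) :=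
    fun w₀ => by
      refine (S.measure_reject_le p w₀ hδ0 hpδ.1 (by linarith [hpδ.2])).trans ?_
      rw [show 5 * κ = 4 * κ + κ by ring, ENNReal.ofReal_add (by positivity) hκ0.le]
      exact add_le_add (hmiss w₀) (ENNReal.ofReal_le_ofReal (by rw [hStol, hSv]; exact hNv1))
  refine ⟨S, fun v => ⟨S.hasResolution p v hδ0.le (by positivity) (by linarith) hε.1.le hreject
    fun w₀ => (S.measure_false_accept_le p w₀ hδ0).trans (by rw [hStol, hSv]; exact hNv2 _),
    fun w₀ => ?_⟩⟩
  refine (S.expectedTime_le p w₀ v (hreject w₀)).trans ?_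
  set y := Real.log (1 / δ) / D with hy
  have hlogδ : 0 ≤ Real.log (1 / δ) := Real.log_nonneg (by
    rw [le_div_iff₀ hδ0]
    linarith)
  have hy0 : 0 ≤ y := div_nonneg hlogδ hD0.le
  have hR : ((S.roundLen : ℕ) : ℝ) ≤ (1 + 2 * θ) * (y + x) := by
    rw [hlen]
    push_cast
    linarith [mul_nonneg hθ0.le hx0]
  calc (S.roundLen : ℝ≥0∞) * (1 - ENNReal.ofReal (5 * κ))⁻¹
      = ENNReal.ofReal (S.roundLen * (1 + θ)) := by
        rw [← ENNReal.ofReal_one, ← ENNReal.ofReal_sub _ (by positivity),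
          ← ENNReal.ofReal_inv_of_pos hρ0, h5κ, ENNReal.ofReal_mul (by positivity),
          ENNReal.ofReal_natCast, one_div, inv_inv]
    _ ≤ ENNReal.ofReal ((y + x) * (1 + η)) := by
        refine ENNReal.ofReal_le_ofReal ?_
        calc (S.roundLen : ℝ) * (1 + θ) ≤ (1 + 2 * θ) * (y + x) * (1 + θ) := by gcongr
          _ = (y + x) * ((1 + 2 * θ) * (1 + θ)) := by ring
          _ ≤ (y + x) * (1 + η) := mul_le_mul_of_nonneg_left hfac (add_nonneg hy0 hx0)
    _ = (ENNReal.ofReal (Real.log (1 / δ)) / ENNReal.ofReal D +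
          ENNReal.ofReal (Real.log (1 / ε)) / capacityOne (p δ)) * ENNReal.ofReal (1 + η) := by
        rw [ENNReal.ofReal_mul (add_nonneg hy0 hx0), ENNReal.ofReal_add hy0 hx0, hx, hy,
          ENNReal.ofReal_div_of_pos hD0]
    _ ≤ _ := by
        gcongr
        -- The coarse search is already paid for by the slack in the `log (1 / δ)` term, so the
        -- nonnegative `α` term can be discarded.
        refine le_trans ?_ le_add_self
        exact ENNReal.div_le_div_left (ENNReal.ofReal_le_ofReal (capacity_le _)) _

lemma AchievesUpTo.mono {p : ℝ → ℝ} {qstar α δ ε η η' : ℝ} {S : TwoPhaseScheme α δ}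
    (h : AchievesUpTo p qstar ε η S) (hη : η ≤ η') : AchievesUpTo p qstar ε η' S :=
  fun v => ⟨(h v).1, fun w₀ => ((h v).2 w₀).trans (by gcongr)⟩

end NoisySearch

end

/-! ### From each fixed `η` to a single `o(1)` -/

theorem theorem2 (p : ℝ → ℝ) (hp : NoisySearch.IsNoiseFunction p)
    (qstar : ℝ) (hqstar : qstar ∈ Set.Ioc (0 : ℝ) (1 / 2))
    (hmax : IsMaxOn (fun q => NoisySearch.mutualInfo q (p q)) (Set.Ioc (0 : ℝ) (1 / 2)) qstar)
    (α : ℝ) (hα : α ∈ Set.Ioo (0 : ℝ) (1 / 2)) :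
    ∃ o : ℝ → ℝ → ℝ,
      Filter.Tendsto (fun x : ℝ × ℝ => o x.1 x.2)
        (nhdsWithin 0 (Set.Ioi 0) ×ˢ nhdsWithin 0 (Set.Ioi 0)) (nhds 0) ∧
      ∃ δ₀ > 0, ∃ ε₀ > 0, ∀ δ ∈ Set.Ioo (0 : ℝ) δ₀, ∀ ε ∈ Set.Ioo (0 : ℝ) ε₀,
        ∃ S : NoisySearch.TwoPhaseScheme α δ, ∀ v : UnitAddCircle,
          (S.toStrategy p v).HasResolution p v δ ε ∧
          ∀ w₀ : UnitAddCircle,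
            (S.toStrategy p v).expectedTime p w₀ v ≤
              (ENNReal.ofReal (Real.log (1 / α)) /
                  ENNReal.ofReal (NoisySearch.capacity (p qstar)) +
                ENNReal.ofReal (Real.log (1 / δ)) /
                  ENNReal.ofReal (NoisySearch.capacity (p α)) +
                ENNReal.ofReal (Real.log (1 / ε)) / NoisySearch.capacityOne (p δ)) *
              ENNReal.ofReal (1 + o δ ε) := by
  let G (δ ε : ℝ) : Set ℝ :=
    {η | 0 < η ∧ ∃ S : NoisySearch.TwoPhaseScheme α δ, NoisySearch.AchievesUpTo p qstar ε η S}
  have hG0 : ∀ δ ε, BddBelow (G δ ε) := fun δ ε => ⟨0, fun η hη => hη.1.le⟩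
  -- The infimum need not be attained; the summand `δ > 0` leaves room for an achievable `η` below
  -- `o δ ε` and vanishes in the limit.
  refine ⟨fun δ ε => sInf (G δ ε) + δ, ?_, ?_⟩
  · rw [Metric.tendsto_nhds]
    intro e he
    obtain ⟨δ₁, hδ₁, h⟩ := NoisySearch.exists_achievesUpTo hp qstar hα (half_pos he)
    have h1 : ∀ᶠ δ : ℝ in nhdsWithin 0 (Set.Ioi 0), δ ∈ Set.Ioo 0 (min δ₁ (e / 2)) :=
      Ioo_mem_nhdsGT (lt_min hδ₁ (half_pos he))
    have h2 : ∀ᶠ ε : ℝ in nhdsWithin 0 (Set.Ioi 0), ε ∈ Set.Ioo (0 : ℝ) 1 :=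
      Ioo_mem_nhdsGT one_pos
    filter_upwards [h1.prod_mk h2] with x hx
    obtain ⟨⟨hx0, hx1⟩, hxε⟩ := hx
    have hmem : e / 2 ∈ G x.1 x.2 :=
      ⟨half_pos he, h x.1 ⟨hx0, hx1.trans_le (min_le_left _ _)⟩ x.2 hxε⟩
    have h3 : sInf (G x.1 x.2) ≤ e / 2 := csInf_le (hG0 _ _) hmem
    have h4 : 0 ≤ sInf (G x.1 x.2) := Real.sInf_nonneg fun η hη => hη.1.le
    rw [Real.dist_eq, sub_zero, abs_of_nonneg (by linarith)]
    linarith [hx1.trans_le (min_le_right δ₁ (e / 2))]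
  · obtain ⟨δ₁, hδ₁, h⟩ := NoisySearch.exists_achievesUpTo hp qstar hα one_pos
    refine ⟨δ₁, hδ₁, 1, one_pos, fun δ hδ ε hε => ?_⟩
    obtain ⟨η, ⟨-, S, hS⟩, hη⟩ := exists_lt_of_csInf_lt (s := G δ ε) ⟨1, one_pos, h δ hδ ε hε⟩
      (lt_add_of_pos_right _ hδ.1)
    exact ⟨S, hS.mono hη.le⟩
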